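/- Let $K=(K,\prec)$ be an abstract elementary class with Löwenheim–Skolem number $\mathrm{LS}(K)$, the least infinite cardinal $\mu\ge|\tau(K)|$ such that every subset $A$ of every $M\in K$ lies in some $N\prec M$ with $|N|\le|A|+\mu$. For a class $\mathcal F$ of cardinals, $K_{\mathcal F}$ is the class of $M\in K$ with $|M|\in\mathcal F$, and $M$ is an *$\mathcal F$-amalgamation base* if $M\in K_{\mathcal F}$ and for any two $K$-embeddings $f_\ell:M\to M_\ell$ with $M_\ell\in K_{\mathcal F}$ ($\ell=1,2$) there are $N\in K$ and $K$-embeddings $g_\ell:M_\ell\to N$ with $g_1f_1=g_2f_2$. We write $\mu$ for $\mathcal F=\{\mu\}$, $<\kappa$ for $\mathcal F=[\mathrm{LS}(K),\kappa)$ and $\le\lambda$ for $\mathcal F=[\mathrm{LS}(K),\lambda]$. Let $\kappa$ be a cardinal with $\mathrm{LS}(K)<\kappa$. 1. Suppose $\kappa$ is weakly compact, i.e. strongly inaccessible and such that every set of at most $\kappa$ sentences of $\mathbb L_{\kappa,\kappa}$ all of whose subsets of size $<\kappa$ are satisfiable is satisfiable. If $M\in K_\kappa$ is the union $\bigcup_{i<\kappa}M_i$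 of a $\prec$-increasing chain (not necessarily continuous) of $<\kappa$-amalgamation bases $M_i$, then $M$ is a $\kappa$-amalgamation base. 2. Suppose $\kappa$ is measurable, i.e. uncountable and carrying a $\kappa$-additive $\{0,1\}$-valued measure, defined on all subsets of $\kappa$, that vanishes on points and gives $\kappa$ measure $1$. If $M\in K$ is the union $\bigcup_{i<\kappa}M_i$ of a $\prec$-increasing chain in which each $M_i$ is a $\lambda_i$-amalgamation base, then $M$ is a $(\sup_{i<\kappa}\lambda_i)$-amalgamation base. 3. Let $\lambda\ge\kappa$ and suppose $\kappa$ is $\lambda$-strongly compact, i.e. there is a $\kappa$-complete fine ultrafilter on $P_\kappa\lambda=\{x\subseteq\lambda:|x|<\kappa\}$. If $M\in K$, $|M|\le\lambda$, and $M=\bigcup_{x\in P_\kappa\lambda}M_x$ where each $M_x$ is a $<\kappa$-amalgamation base and $M_x\prec M_y$ whenever $x\subseteq y$, then $M$ is a $\le\lambda$-amalgamation base. -/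

import Mathlib

open FirstOrder Cardinal Set

universe u

namespace AECLC

/-! ### Abstract elementary classes -/

/-- A class `K` of `L`-structures together with a relation `≺` of strong substructure.
`Mem M` says `M ∈ K`; for a substructure `S` of `N`, `Strong S` says `S ≺ N`. -/
structure StrongClass (L : FirstOrder.Language.{u, u}) where
  Mem : ∀ (M : Type u) [L.Structure M], Prop
  Strong : ∀ {N : Type u} [L.Structure N], L.Substructure N → Prop

namespace StrongClass

variable {L : FirstOrder.Language.{u, u}} (K : StrongClass L)

/-- A `K`-embedding: an embedding whose range is a strong substructure of its target. -/
def IsEmb {M N : Type u} [L.Structure M] [L.Structure N] (f : M ↪[L] N) : Prop :=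
  K.Strong f.toHom.range

/-- `S ≺ T`, for two substructures `S`, `T` of one structure. -/
def StrongLE {N : Type u} [L.Structure N] (S T : L.Substructure N) : Prop :=
  ∃ h : S ≤ T, K.IsEmb (FirstOrder.Language.Substructure.inclusion h)

/-- `μ` is an infinite cardinal, at least the size of the vocabulary, such that each subset `A` of
each `M ∈ K` lies in some `S ≺ M` with `|S| ≤ |A| + μ`. -/
def IsLSBound (μ : Cardinal.{u}) : Prop :=
  ℵ₀ ≤ μ ∧ L.card ≤ μ ∧
    ∀ (M : Type u) [L.Structure M], K.Mem M → ∀ A : Set M,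
      ∃ S : L.Substructure M, K.Strong S ∧ A ⊆ (S : Set M) ∧ #S ≤ #A + μ

end StrongClass

/-- At limit indices the member of the family is the union of the earlier members. -/
def IsContinuousFamily {L : FirstOrder.Language.{u, u}} {N : Type u} [L.Structure N]
    {I : Type u} [LinearOrder I] (M : I → L.Substructure N) : Prop :=
  ∀ i, Order.IsSuccLimit i → (M i : Set N) = ⋃ j ∈ Iio i, (M j : Set N)

/-- Abstract elementary classes in the vocabulary `L`. -/
structure AEC (L : FirstOrder.Language.{u, u}) extends StrongClass L where
  /-- `≺` relates members of `K`. -/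
  mem_of_strong : ∀ {N : Type u} [L.Structure N] (S : L.Substructure N), Strong S → Mem S ∧ Mem N
  /-- `K` is closed under isomorphism. -/
  mem_of_iso : ∀ {M N : Type u} [L.Structure M] [L.Structure N] (_ : M ≃[L] N), Mem M → Mem N
  /-- `≺` is closed under isomorphism. -/
  strong_of_iso : ∀ {M N : Type u} [L.Structure M] [L.Structure N] (e : M ≃[L] N)
    (S : L.Substructure M), Strong S → Strong (S.map e.toHom)
  /-- `≺` is reflexive on `K`. -/
  strong_refl : ∀ (N : Type u) [L.Structure N], Mem N → Strong (⊤ : L.Substructure N)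
  /-- `≺` is transitive. -/
  strong_trans : ∀ {N : Type u} [L.Structure N] (S T : L.Substructure N),
    toStrongClass.StrongLE S T → Strong T → Strong S
  /-- Coherence: if `S ⊆ T`, `S ≺ N` and `T ≺ N`, then `S ≺ T`. -/
  coherence : ∀ {N : Type u} [L.Structure N] (S T : L.Substructure N),
    S ≤ T → Strong S → Strong T → toStrongClass.StrongLE S T
  /-- The union `N` of a continuous `≺`-increasing chain lies in `K`, and each member of the chain
  is strong in it. -/
  chain_union : ∀ {N : Type u} [L.Structure N] (I : Type u) [LinearOrder I] [WellFoundedLT I]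
    [Nonempty I] (M : I → L.Substructure N),
    (∀ i j, i ≤ j → toStrongClass.StrongLE (M i) (M j)) → IsContinuousFamily M →
    (⋃ i, (M i : Set N)) = Set.univ → Mem N ∧ ∀ i, Strong (M i)
  /-- Smoothness: the union of a continuous increasing chain of strong substructures of `P` is a
  strong substructure of `P`. -/
  chain_smooth : ∀ {P : Type u} [L.Structure P] (I : Type u) [LinearOrder I] [WellFoundedLT I]
    [Nonempty I] (M : I → L.Substructure P),
    (∀ i j, i ≤ j → toStrongClass.StrongLE (M i) (M j)) → IsContinuousFamily M →
    (∀ i, Strong (M i)) → ∀ S : L.Substructure P, (S : Set P) = (⋃ i, (M i : Set P)) → Strong S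
  /-- There is a Löwenheim–Skolem cardinal. -/
  exists_LS : ∃ μ, toStrongClass.IsLSBound μ

namespace AEC

variable {L : FirstOrder.Language.{u, u}} (K : AEC L)

/-- The Löwenheim–Skolem number `LS(K)`. -/
noncomputable def LS : Cardinal.{u} := sInf {μ | K.IsLSBound μ}

/-- `M` is an `F`-amalgamation base: `M ∈ K` has size in `F`, and any two `K`-extensions of `M`
with sizes in `F` can be amalgamated over `M`. -/
def IsAmalgamationBase (F : Set Cardinal.{u}) (M : Type u) [L.Structure M] : Prop :=
  K.Mem M ∧ #M ∈ F ∧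
    ∀ (M₁ M₂ : Type u) [L.Structure M₁] [L.Structure M₂] (f₁ : M ↪[L] M₁) (f₂ : M ↪[L] M₂),
      #M₁ ∈ F → #M₂ ∈ F → K.IsEmb f₁ → K.IsEmb f₂ →
      ∃ (N : Type u) (_ : L.Structure N) (g₁ : M₁ ↪[L] N) (g₂ : M₂ ↪[L] N),
        K.IsEmb g₁ ∧ K.IsEmb g₂ ∧ ∀ m : M, g₁ (f₁ m) = g₂ (f₂ m)

/-- `M` is the `≺`-directed union of the family `Ms` of its substructures, over the partial
order `I`. -/
def IsUnionOf {M : Type u} [L.Structure M] {I : Type u} [PartialOrder I]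
    (Ms : I → L.Substructure M) : Prop :=
  (∀ i j, i ≤ j → K.StrongLE (Ms i) (Ms j)) ∧ (⋃ i, (Ms i : Set M)) = Set.univ

end AEC

/-! ### The infinitary logics `L_{κ,κ}` -/

/-- Formulas of `L_{κ,κ}` with free variables indexed by `α`: conjunctions of fewer than `κ`
formulas and universal quantification over fewer than `κ` variables at once are allowed. -/
inductive InfFormula (L : FirstOrder.Language.{u, u}) (κ : Cardinal.{u}) : Type u → Type (u + 1)
  | equal {α : Type u} (t₁ t₂ : L.Term α) : InfFormula L κ α
  | rel {α : Type u} {n : ℕ} (R : L.Relations n) (ts : Fin n → L.Term α) : InfFormula L κ α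
  | neg {α : Type u} (φ : InfFormula L κ α) : InfFormula L κ α
  | conj {α : Type u} (I : Type u) (hI : #I < κ) (φ : I → InfFormula L κ α) : InfFormula L κ α
  | all {α : Type u} (β : Type u) (hβ : #β < κ) (φ : InfFormula L κ (α ⊕ β)) : InfFormula L κ α

/-- Satisfaction of an `L_{κ,κ}`-formula under an assignment. -/
def InfFormula.Realize {L : FirstOrder.Language.{u, u}} {κ : Cardinal.{u}} (M : Type u) [L.Structure M] :
    ∀ {α : Type u}, InfFormula L κ α → (α → M) → Prop
  | _, .equal t₁ t₂, v => t₁.realize v = t₂.realize v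
  | _, .rel R ts, v => FirstOrder.Language.Structure.RelMap R fun i => (ts i).realize v
  | _, .neg φ, v => ¬ φ.Realize M v
  | _, .conj _ _ φ, v => ∀ i, (φ i).Realize M v
  | _, .all β _ φ, v => ∀ w : β → M, φ.Realize M (Sum.elim v w)

/-- Sentences of `L_{κ,κ}`. -/
abbrev InfSentence (L : FirstOrder.Language.{u, u}) (κ : Cardinal.{u}) : Type (u + 1) :=
  InfFormula L κ PEmpty.{u + 1}

/-- A set of `L_{κ,κ}`-sentences has a (non-empty) model. -/
def InfSatisfiable {L : FirstOrder.Language.{u, u}} {κ : Cardinal.{u}} (T : Set (InfSentence L κ)) : Prop :=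
  ∃ (M : Type u) (_ : L.Structure M), Nonempty M ∧ ∀ φ ∈ T, φ.Realize M PEmpty.elim

/-! ### Large cardinals -/

/-- `κ` is weakly compact: it is strongly inaccessible, and every set of at most `κ` sentences of
`L_{κ,κ}`, each of whose subsets of size `< κ` is satisfiable, is satisfiable. -/
def IsWeaklyCompact (κ : Cardinal.{u}) : Prop :=
  κ.IsInaccessible ∧
    ∀ (L : FirstOrder.Language.{u, u}) (T : Set (InfSentence L κ)), #T ≤ Cardinal.lift.{u + 1} κ →
      (∀ T₀ ⊆ T, #T₀ < Cardinal.lift.{u + 1} κ → InfSatisfiable T₀) → InfSatisfiable T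

/-- `κ` is measurable: it is uncountable, and there is a `κ`-additive, `{0,1}`-valued measure,
defined on all subsets of `κ`, that gives measure `1` to `κ` and `0` to every point. -/
def IsMeasurable (κ : Cardinal.{u}) : Prop :=
  ℵ₀ < κ ∧ ∃ m : Set κ.ord.ToType → ENNReal,
    (∀ A, m A = 0 ∨ m A = 1) ∧ m Set.univ = 1 ∧ (∀ a, m {a} = 0) ∧
    ∀ 𝒜 : Set (Set κ.ord.ToType), #𝒜 < κ → 𝒜.PairwiseDisjoint id → m (⋃₀ 𝒜) = ∑' A : 𝒜, m A

/-- `P_κ λ`, the set of subsets of `λ` of size less than `κ`, ordered by inclusion. -/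
abbrev Pk (κ lam : Cardinal.{u}) : Type u := {x : Set lam.ord.ToType // #x < κ}

/-- `κ` is `(δ, λ)`-strongly compact: `δ ≤ κ ≤ λ` and there is a `δ`-complete fine ultrafilter
on `P_κ λ`. -/
def IsStronglyCompactBetween (δ κ lam : Cardinal.{u}) : Prop :=
  δ ≤ κ ∧ κ ≤ lam ∧ ∃ U : Ultrafilter (Pk κ lam),
    (∀ 𝒮 : Set (Set (Pk κ lam)), #𝒮 < δ → (∀ A ∈ 𝒮, A ∈ U) → ⋂₀ 𝒮 ∈ U) ∧
    ∀ a : lam.ord.ToType, {x : Pk κ lam | a ∈ x.1} ∈ U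

/-- `κ` is `λ`-strongly compact. -/
def IsStronglyCompactUpTo (κ lam : Cardinal.{u}) : Prop := IsStronglyCompactBetween κ κ lam

end AECLC

/-!
In each of the three cases the index set carries a filter `F`, closed under intersections of fewer
than `κ` sets, along which the chain exhausts `M`, and relative to which the truth of few formulas
at an index can be decided coherently: an ultrafilter for measurable and strongly compact `κ`; the
filter of end segments for weakly compact `κ`, where compactness of a propositional theory with one
variable for each set of indices makes the decisions.

Given `K`-embeddings `M → M₁` and `M → M₂`, choose for every index `i` small strong submodels of
`M₁` and `M₂` containing the images of `M i`, exhausting `M₁` and `M₂` along `F`, and amalgamate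
them over `M i` inside some `P i`. Elements of `M₁` and `M₂` become sections of the family `P`.
Close every finite set of elements to a system of at most `LS(K)` sections that cuts out a strong
submodel of each `P i`, and evaluate it at an index satisfying the formulas decided by `F`. As the
decisions are coherent, the values form a directed system of `K`-embeddings, and its limit
amalgamates `M₁` and `M₂` over `M`.

The axioms speak only of continuous well-ordered chains. Directed unions reduce to families indexed
by finite subsets of a well-ordered set, and these to chains by transfinite induction.
-/

namespace AECLC

open FirstOrder.Language Filter

namespace AEC

variable {L : FirstOrder.Language.{u, u}} (K : AEC L)

section Embeddings

variable {M N P : Type u} [L.Structure M] [L.Structure N] [L.Structure P]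

theorem strong_map_equiv_iff (e : M ≃[L] N) (S : L.Substructure M) :
    K.Strong (S.map e.toHom) ↔ K.Strong S := by
  refine ⟨fun h => ?_, K.strong_of_iso e S⟩
  have map_map_symm : (S.map e.toHom).map e.symm.toHom = S := by
    ext x
    simp [Substructure.mem_map]
  exact map_map_symm ▸ K.strong_of_iso e.symm _ h

theorem strongLE_range_comp_iff (g : N ↪[L] P) (f : M ↪[L] N) :
    K.StrongLE (g.comp f).toHom.range g.toHom.range ↔ K.IsEmb f := by
  have range_inclusion (h : (g.comp f).toHom.range ≤ g.toHom.range) :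
      (Substructure.inclusion h).toHom.range = f.toHom.range.map g.equivRange.toHom := by
    ext x
    simp only [Hom.mem_range, Substructure.mem_map]
    constructor
    · rintro ⟨⟨_, m, rfl⟩, rfl⟩
      exact ⟨f m, ⟨m, rfl⟩, rfl⟩
    · rintro ⟨_, ⟨m, rfl⟩, rfl⟩
      exact ⟨⟨g (f m), m, rfl⟩, rfl⟩
  simp only [StrongClass.StrongLE, StrongClass.IsEmb, range_inclusion, strong_map_equiv_iff]
  exact and_iff_right (Hom.range_comp_le_range f.toHom g.toHom) |> exists_prop.trans

variable {K}

theorem mem_of_isEmb {f : M ↪[L] N} (hf : K.IsEmb f) : K.Mem N :=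
  (K.mem_of_strong _ hf).2

theorem isEmb_comp {g : N ↪[L] P} {f : M ↪[L] N} (hg : K.IsEmb g) (hf : K.IsEmb f) :
    K.IsEmb (g.comp f) :=
  K.strong_trans _ _ ((K.strongLE_range_comp_iff g f).2 hf) hg

theorem isEmb_of_comp {g : N ↪[L] P} {f : M ↪[L] N} (hg : K.IsEmb g)
    (hgf : K.IsEmb (g.comp f)) : K.IsEmb f :=
  (K.strongLE_range_comp_iff g f).1
    (K.coherence _ _ (Hom.range_comp_le_range f.toHom g.toHom) hgf hg)

theorem isEmb_equiv_comp (e : N ≃[L] P) {f : M ↪[L] N} (hf : K.IsEmb f) :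
    K.IsEmb (e.toEmbedding.comp f) := by
  have range_comp : (e.toEmbedding.comp f).toHom.range = f.toHom.range.map e.toHom :=
    Hom.range_comp f.toHom e.toHom
  simpa only [StrongClass.IsEmb, range_comp] using K.strong_of_iso e _ hf

theorem isEmb_comp_equiv {f : N ↪[L] P} (e : M ≃[L] N) (hf : K.IsEmb f) :
    K.IsEmb (f.comp e.toEmbedding) := by
  have range_comp : (f.comp e.toEmbedding).toHom.range = f.toHom.range :=
    SetLike.coe_injective (EquivLike.range_comp f e)
  simpa only [StrongClass.IsEmb, range_comp] using hf

variable (K) in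
theorem isEmb_subtype_iff (S : L.Substructure N) : K.IsEmb S.subtype ↔ K.Strong S := by
  simp only [StrongClass.IsEmb, Substructure.range_subtype]

theorem isEmb_codRestrict {f : M ↪[L] N} (hf : K.IsEmb f) {S : L.Substructure N}
    (hS : K.Strong S) (h : ∀ m, f m ∈ S) : K.IsEmb (f.codRestrict S h) := by
  refine isEmb_of_comp ((K.isEmb_subtype_iff S).2 hS) ?_
  rwa [Embedding.subtype_comp_codRestrict]

theorem strongLE_trans {S T U : L.Substructure N} (hST : K.StrongLE S T)
    (hTU : K.StrongLE T U) : K.StrongLE S U := by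
  obtain ⟨hle, hS⟩ := hST
  obtain ⟨hle', hT⟩ := hTU
  exact ⟨hle.trans hle', isEmb_comp hT hS⟩

variable (K) in
theorem strongLE_top_iff (S : L.Substructure N) : K.StrongLE S ⊤ ↔ K.Strong S := by
  rw [← K.isEmb_subtype_iff]
  exact ⟨fun ⟨_, h⟩ => isEmb_equiv_comp Substructure.topEquiv h,
    fun h => ⟨le_top, isEmb_equiv_comp Substructure.topEquiv.symm h⟩⟩

end Embeddings

end AEC

section MonotoneMajorant

variable {X : Type*} {α : Type*} [Preorder α] [IsDirectedOrder α] [Nonempty α]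

open scoped Classical in
/-- A monotone majorant of a map from finite sets to a directed order, obtained by choosing at each
finite set an upper bound of the given value and of the values already chosen at its subsets. -/
noncomputable def monotoneMajorant (base : Finset X → α) (e : Finset X) : α :=
  (Finset.exists_le (insert (base e) (e.ssubsets.attach.image fun e' : e.ssubsets =>
    have : e'.1.card < e.card := Finset.card_lt_card (Finset.mem_ssubsets.1 e'.2)
    monotoneMajorant base e'.1))).choose
termination_by e.card

theorem monotone_monotoneMajorant (base : Finset X → α) : Monotone (monotoneMajorant base) := by
  classical
  intro e' e h
  obtain rfl | h := h.eq_or_ssubset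
  · exact le_rfl
  · rw [monotoneMajorant.eq_1 base e]
    exact (Finset.exists_le _).choose_spec _ (Finset.mem_insert_of_mem (Finset.mem_image.2
      ⟨⟨e', Finset.mem_ssubsets.2 h⟩, Finset.mem_attach _ _, rfl⟩))

theorem le_monotoneMajorant (base : Finset X → α) (e : Finset X) :
    base e ≤ monotoneMajorant base e := by
  classical
  rw [monotoneMajorant.eq_1 base e]
  exact (Finset.exists_le _).choose_spec _ (Finset.mem_insert_self _ _)

end MonotoneMajorant

namespace AEC

variable {L : FirstOrder.Language.{u, u}} (K : AEC L) {N : Type u} [L.Structure N]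

/-- The union of a family of substructures that is directed for `≺`, characterised by its
properties: every member is strong in `⨆ d, S d`, and `⨆ d, S d` is strong in every common
strong extension. -/
structure HasStrongSup {D : Type*} (S : D → L.Substructure N) : Prop where
  strongLE_iSup : ∀ d, K.StrongLE (S d) (⨆ d, S d)
  iSup_strongLE : ∀ U, (∀ d, K.StrongLE (S d) U) → K.StrongLE (⨆ d, S d) U

variable {K}

theorem mem_iSup_of_strongLE {D : Type*} [Preorder D] [IsDirectedOrder D] [Nonempty D]
    {S : D → L.Substructure N} (hS : ∀ d d', d ≤ d' → K.StrongLE (S d) (S d')) {x : N} :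
    x ∈ ⨆ d, S d ↔ ∃ d, x ∈ S d :=
  Substructure.mem_iSup_of_directed (Monotone.directed_le fun d d' h => (hS d d' h).1)

section Chains

variable {I : Type u} [LinearOrder I] {S : I → L.Substructure N}

theorem mem_range_inclusion {S T : L.Substructure N} (h : S ≤ T) {x : T} :
    x ∈ (Substructure.inclusion h).toHom.range ↔ x.1 ∈ S :=
  ⟨fun ⟨y, hy⟩ => hy ▸ y.2, fun hx => ⟨⟨x.1, hx⟩, rfl⟩⟩

theorem strongLE_range_inclusion {S S' T : L.Substructure N} (h : S ≤ T) (h' : S' ≤ T)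
    (hS : K.StrongLE S S') : K.StrongLE (Substructure.inclusion h).toHom.range
      (Substructure.inclusion h').toHom.range :=
  (K.strongLE_range_comp_iff (Substructure.inclusion h') (Substructure.inclusion hS.1)).2 hS.2

theorem isContinuousFamily_range_inclusion (hS : IsContinuousFamily S) {T : L.Substructure N}
    (hT : ∀ i, S i ≤ T) :
    IsContinuousFamily fun i => (Substructure.inclusion (hT i)).toHom.range := by
  intro i hi
  ext x
  simpa only [SetLike.mem_coe, mem_iUnion, mem_range_inclusion] using Set.ext_iff.1 (hS i hi) x.1

theorem hasStrongSup_of_isContinuousFamily [WellFoundedLT I] [Nonempty I]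
    (hS : ∀ i j, i ≤ j → K.StrongLE (S i) (S j)) (hc : IsContinuousFamily S) :
    K.HasStrongSup S where
  strongLE_iSup i := by
    have hT := le_iSup S
    refine ⟨hT i, (K.chain_union I _ (fun i j hij => strongLE_range_inclusion (hT i) (hT j)
      (hS i j hij)) (isContinuousFamily_range_inclusion hc hT) ?_).2 i⟩
    ext x
    simpa only [mem_iUnion, SetLike.mem_coe, mem_range_inclusion, mem_univ, iff_true]
      using (mem_iSup_of_strongLE hS).1 x.2
  iSup_strongLE U hU := by
    have hSU := fun i => (hU i).1
    refine ⟨iSup_le hSU, K.chain_smooth I _ (fun i j hij => strongLE_range_inclusion (hSU i)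
      (hSU j) (hS i j hij)) (isContinuousFamily_range_inclusion hc hSU) (fun i => (hU i).2) _ ?_⟩
    ext x
    simp only [SetLike.mem_coe, mem_iUnion, mem_range_inclusion, mem_iSup_of_strongLE hS]

end Chains

theorem HasStrongSup.of_interleaved {D E : Type*} {S : D → L.Substructure N}
    {R : E → L.Substructure N} (hR : K.HasStrongSup R) (hSR : ∀ d, ∃ e, K.StrongLE (S d) (R e))
    (hle : ∀ e, R e ≤ ⨆ d, S d) (hRU : ∀ U, (∀ d, K.StrongLE (S d) U) → ∀ e, K.StrongLE (R e) U) :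
    K.HasStrongSup S := by
  have iSup_eq : ⨆ e, R e = ⨆ d, S d :=
    le_antisymm (iSup_le hle) (iSup_le fun d =>
      let ⟨e, he⟩ := hSR d
      he.1.trans (le_iSup R e))
  exact ⟨fun d =>
    let ⟨e, he⟩ := hSR d
    iSup_eq ▸ strongLE_trans he (hR.strongLE_iSup e),
    fun U hU => iSup_eq ▸ hR.iSup_strongLE U (hRU U hU)⟩

section FinitelySupported

variable {Y : Type u} [LinearOrder Y]

/-- The members of a family indexed by finite sets whose index lies below `a`. Induction on `a`
controls their union by the axioms on chains: below a limit `a` it is the union of a continuous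
chain, below a successor that of a family already treated. -/
def famBelow (S : Finset Y → L.Substructure N) (a : Y)
    (e : {e : Finset Y // ∀ y ∈ e, y < a}) : L.Substructure N := S e

theorem exists_forall_lt_of_isSuccLimit {a : Y} (ha : Order.IsSuccLimit a) {e : Finset Y}
    (he : ∀ y ∈ e, y < a) : ∃ b < a, ∀ y ∈ e, y < b := by
  obtain rfl | hne := e.eq_empty_or_nonempty
  · obtain ⟨b, hb⟩ := not_isMin_iff.1 ha.1
    exact ⟨b, hb, by simp⟩
  · obtain ⟨b, hb, hmax⟩ := ha.2.lt_iff_exists_lt.1 ((e.max'_lt_iff hne).2 he)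
    exact ⟨b, hb, (e.max'_lt_iff hne).1 hmax⟩

variable {S : Finset Y → L.Substructure N}

theorem hasStrongSup_famBelow_of_isMin (hS : ∀ e e', e ≤ e' → K.StrongLE (S e) (S e')) {a : Y}
    (ha : IsMin a) : K.HasStrongSup (famBelow S a) := by
  have eq_empty (e : {e : Finset Y // ∀ y ∈ e, y < a}) : e.1 = ∅ :=
    Finset.eq_empty_of_forall_notMem fun y hy => ha.not_lt (e.2 y hy)
  have famBelow_eq : famBelow S a = fun _ => S ∅ := funext fun e => congrArg S (eq_empty e)
  have : Nonempty {e : Finset Y // ∀ y ∈ e, y < a} := ⟨⟨∅, by simp⟩⟩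
  rw [famBelow_eq]
  refine ⟨fun _ => ?_, fun U hU => ?_⟩ <;> rw [iSup_const]
  · exact hS ∅ ∅ le_rfl
  · exact hU ⟨∅, by simp⟩

theorem hasStrongSup_famBelow_of_covBy (hS : ∀ e e', e ≤ e' → K.StrongLE (S e) (S e')) {a b : Y}
    (hba : b ⋖ a) (ih : K.HasStrongSup (famBelow (fun e => S (insert b e)) b)) :
    K.HasStrongSup (famBelow S a) := by
  have lt_of_mem_insert (e : {e : Finset Y // ∀ y ∈ e, y < b}) : ∀ y ∈ insert b e.1, y < a := by
    simpa using ⟨hba.lt, fun y hy => (e.2 y hy).trans hba.lt⟩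
  refine ih.of_interleaved (fun e => ⟨⟨e.1.erase b, fun y hy => ?_⟩, hS _ _ ?_⟩)
    (fun e => le_iSup (famBelow S a) ⟨_, lt_of_mem_insert e⟩)
    (fun U hU e => hU ⟨_, lt_of_mem_insert e⟩)
  · obtain ⟨hne, hmem⟩ := Finset.mem_erase.1 hy
    exact (hba.le_of_lt (e.2 y hmem)).lt_of_ne hne
  · exact Finset.insert_erase_subset b e.1

theorem hasStrongSup_famBelow_of_isSuccLimit [WellFoundedLT Y]
    {a : Y} (ha : Order.IsSuccLimit a)
    (ih : ∀ b < a, K.HasStrongSup (famBelow S b)) : K.HasStrongSup (famBelow S a) := by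
  have : Nonempty (Iio a) := nonempty_subtype.2 (not_isMin_iff.1 ha.1)
  let V (b : Iio a) : L.Substructure N := ⨆ e, famBelow S b.1 e
  have strongLE_V (b : Iio a) (e : Finset Y) (he : ∀ y ∈ e, y < b.1) : K.StrongLE (S e) (V b) :=
    (ih b b.2).strongLE_iSup ⟨e, he⟩
  have V_strongLE (b : Iio a) (U : L.Substructure N)
      (hU : ∀ e : Finset Y, (∀ y ∈ e, y < b.1) → K.StrongLE (S e) U) : K.StrongLE (V b) U :=
    (ih b b.2).iSup_strongLE U fun e => hU e.1 e.2
  have V_mono (b c : Iio a) (hbc : b ≤ c) : K.StrongLE (V b) (V c) :=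
    V_strongLE b _ fun e he => strongLE_V c e fun y hy => (he y hy).trans_le hbc
  have V_continuous : IsContinuousFamily V := by
    intro b hb
    have : Nonempty (Iio b) := nonempty_subtype.2 (not_isMin_iff.1 hb.1)
    have V_eq : V b = ⨆ c : Iio b, V c := by
      refine le_antisymm (iSup_le fun e => ?_) (iSup_le fun c => (V_mono c b c.2.le).1)
      obtain ⟨c, hcb, hc⟩ := exists_forall_lt_of_isSuccLimit
        ((principalSegIio a).isSuccLimit_apply_iff.2 hb) e.2
      exact (strongLE_V ⟨c, hcb.trans b.2⟩ e hc).1.trans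
        (le_iSup (fun c : Iio b => V c) ⟨⟨c, hcb.trans b.2⟩, hcb⟩)
    ext x
    rw [V_eq, SetLike.mem_coe, mem_iSup_of_strongLE fun c d h => V_mono c.1 d.1 h]
    simp only [Subtype.exists, mem_iUnion, SetLike.mem_coe, exists_prop]
  refine (hasStrongSup_of_isContinuousFamily V_mono V_continuous).of_interleaved
    (fun e => ?_) (fun b => iSup_le fun e => ?_) (fun U hU b => ?_)
  · obtain ⟨b, hba, hb⟩ := exists_forall_lt_of_isSuccLimit ha e.2
    exact ⟨⟨b, hba⟩, strongLE_V ⟨b, hba⟩ e hb⟩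
  · exact le_iSup (famBelow S a) ⟨e, fun y hy => (e.2 y hy).trans b.2⟩
  · exact V_strongLE b U fun e he => hU ⟨e, fun y hy => (he y hy).trans b.2⟩

theorem hasStrongSup_famBelow [WellFoundedLT Y] (a : Y)
    (hS : ∀ e e', e ≤ e' → K.StrongLE (S e) (S e')) : K.HasStrongSup (famBelow S a) := by
  induction a using WellFoundedLT.induction generalizing S with
  | ind a ih =>
    by_cases hmin : IsMin a
    · exact hasStrongSup_famBelow_of_isMin hS hmin
    by_cases hpre : Order.IsSuccPrelimit a
    · exact hasStrongSup_famBelow_of_isSuccLimit ⟨hmin, hpre⟩ fun b hb => ih b hb hS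
    · obtain ⟨b, hba⟩ := Order.not_isSuccPrelimit_iff.1 hpre
      exact hasStrongSup_famBelow_of_covBy hS hba
        (ih b hba.lt fun e e' h => hS _ _ (Finset.insert_subset_insert b h))

end FinitelySupported

theorem hasStrongSup_of_finset {X : Type u} {S : Finset X → L.Substructure N}
    (hS : ∀ e e', e ≤ e' → K.StrongLE (S e) (S e')) : K.HasStrongSup S := by
  obtain ⟨_, _⟩ := exists_wellFoundedLT X
  have below_top := hasStrongSup_famBelow (Y := WithTop X)
    (S := fun e => S (Finset.eraseNone e)) ⊤ fun e e' h => hS _ _ (Finset.eraseNone.monotone h)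
  refine below_top.of_interleaved (fun e => ⟨⟨e.map Function.Embedding.some, fun y hy => ?_⟩, ?_⟩)
    (fun e => le_iSup S _) (fun U hU e => hU _)
  · obtain ⟨x, -, rfl⟩ := Finset.mem_map.1 hy
    exact WithTop.coe_lt_top x
  · exact hS _ _ (Finset.eraseNone_map_some e).ge

section Directed

variable {D : Type u} [PartialOrder D] [IsDirectedOrder D] [Nonempty D]
  {S : D → L.Substructure N}

theorem hasStrongSup_of_directed (hS : ∀ d d', d ≤ d' → K.StrongLE (S d) (S d')) :
    K.HasStrongSup S := by
  choose ub le_ub using fun e : Finset D => e.exists_le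
  have le_majorant (d : D) : d ≤ monotoneMajorant ub {d} :=
    (le_ub {d} d (Finset.mem_singleton_self d)).trans (le_monotoneMajorant ub {d})
  have finset_sup := hasStrongSup_of_finset (S := S ∘ monotoneMajorant ub)
    fun e e' h => hS _ _ (monotone_monotoneMajorant ub h)
  exact finset_sup.of_interleaved (fun d => ⟨{d}, hS _ _ (le_majorant d)⟩)
    (fun e => le_iSup S _) (fun U hU e => hU _)

theorem strong_of_iSup_eq_top (hS : ∀ d d', d ≤ d' → K.StrongLE (S d) (S d'))
    (htop : ⨆ d, S d = ⊤) (d : D) : K.Strong (S d) :=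
  (K.strongLE_top_iff _).1 (htop ▸ (hasStrongSup_of_directed hS).strongLE_iSup d)

theorem strong_iSup (hmono : Monotone S) (hS : ∀ d, K.Strong (S d)) : K.Strong (⨆ d, S d) :=
  (K.strongLE_top_iff _).1 ((hasStrongSup_of_directed fun d d' h =>
    K.coherence _ _ (hmono h) (hS d) (hS d')).iSup_strongLE ⊤
      fun d => (K.strongLE_top_iff _).2 (hS d))

end Directed

end AEC

namespace AEC

variable {L : FirstOrder.Language.{u, u}} (K : AEC L)

section LocalEmbeddings

variable {M N P : Type u} [L.Structure M] [L.Structure N] [L.Structure P]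

/-- The restriction of the map `f` to the substructure `A` is a `K`-embedding. -/
def IsEmbOn (f : M → P) (A : L.Substructure M) : Prop :=
  ∃ g : A ↪[L] P, K.IsEmb g ∧ ∀ a, g a = f a

variable {K} {f : M → P} {A B : L.Substructure M}

theorem IsEmbOn.mono (hf : K.IsEmbOn f A) (hBA : K.StrongLE B A) : K.IsEmbOn f B := by
  obtain ⟨g, hg, hgf⟩ := hf
  obtain ⟨hle, hB⟩ := hBA
  exact ⟨g.comp (Substructure.inclusion hle), isEmb_comp hg hB, fun b => hgf _⟩

theorem IsEmbOn.comp (hf : K.IsEmbOn f A) {S : L.Substructure P} (hS : K.Strong S)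
    (hAS : ∀ a ∈ A, f a ∈ S) {ι : S ↪[L] N} (hι : K.IsEmb ι) {k : M → N}
    (hk : ∀ a (ha : a ∈ A), k a = ι ⟨f a, hAS a ha⟩) : K.IsEmbOn k A := by
  obtain ⟨g, hg, hgf⟩ := hf
  have g_mem (a : A) : g a ∈ S := hgf a ▸ hAS a a.2
  refine ⟨ι.comp (g.codRestrict S g_mem), isEmb_comp hι (isEmb_codRestrict hg hS g_mem),
    fun a => ?_⟩
  rw [hk a a.2]
  exact congrArg ι (Subtype.ext (hgf a))

theorem exists_isEmb_eq_of_isEmbOn {E : Type u} [PartialOrder E] [IsDirectedOrder E] [Nonempty E]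
    {B : E → L.Substructure M} (hB : Monotone B) (hcov : ∀ m, ∃ e, m ∈ B e)
    (hf : ∀ e, K.IsEmbOn f (B e)) : ∃ k : M ↪[L] P, K.IsEmb k ∧ ∀ m, k m = f m := by
  choose g hg hgf using hf
  choose ε hε using hcov
  have exists_common {n : ℕ} (x : Fin n → M) : ∃ e, ∀ i, x i ∈ B e := by
    obtain ⟨e, he⟩ := Finite.exists_le fun i => ε (x i)
    exact ⟨e, fun i => hB (he i) (hε _)⟩
  let k : M ↪[L] P :=
    { toFun := f
      inj' := fun x y hxy => by
        obtain ⟨e, hx, hy⟩ := exists_ge_ge (ε x) (ε y)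
        have hgxy : g e ⟨x, hB hx (hε x)⟩ = g e ⟨y, hB hy (hε y)⟩ := by simpa only [hgf] using hxy
        exact congrArg Subtype.val ((g e).injective hgxy)
      map_fun' := fun F x => by
        obtain ⟨e, hx⟩ := exists_common x
        have := (g e).map_fun F fun i => ⟨x i, hx i⟩
        simp only [Function.comp_def, hgf] at this
        exact this
      map_rel' := fun R x => by
        obtain ⟨e, hx⟩ := exists_common x
        have := (g e).map_rel R fun i => ⟨x i, hx i⟩
        simp only [Function.comp_def, hgf] at this
        exact this }
  have range_g (e : E) : (g e).toHom.range = (B e).map k.toHom := by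
    ext y
    simp only [Hom.mem_range, Substructure.mem_map]
    exact ⟨fun ⟨b, hb⟩ => ⟨b, b.2, (hgf e b).symm.trans hb⟩,
      fun ⟨m, hm, hy⟩ => ⟨⟨m, hm⟩, (hgf e _).trans hy⟩⟩
  have range_k : k.toHom.range = ⨆ e, (B e).map k.toHom := by
    have iSup_B : ⨆ e, B e = ⊤ := eq_top_iff.2 fun m _ => le_iSup B (ε m) (hε m)
    rw [← Substructure.map_iSup, iSup_B, Hom.range_eq_map]
  refine ⟨k, ?_, fun m => rfl⟩
  rw [StrongClass.IsEmb, range_k]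
  exact strong_iSup (fun e e' h => Substructure.monotone_map (hB h)) fun e => range_g e ▸ hg e

end LocalEmbeddings

theorem isLSBound_LS : K.IsLSBound K.LS := csInf_mem K.exists_LS

theorem aleph0_le_LS : ℵ₀ ≤ K.LS := K.isLSBound_LS.1

theorem exists_strong_superset {M : Type u} [L.Structure M] (hM : K.Mem M) {μ : Cardinal.{u}}
    (hμ : K.LS ≤ μ) {A : Set M} (hA : #A ≤ μ) :
    ∃ S : L.Substructure M, K.Strong S ∧ A ⊆ S ∧ #S ≤ μ := by
  obtain ⟨S, hS, hAS, hcard⟩ := K.isLSBound_LS.2.2 M hM A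
  exact ⟨S, hS, hAS, hcard.trans (add_le_of_le (K.aleph0_le_LS.trans hμ) hA hμ)⟩

theorem exists_strong_cover {M : Type u} [L.Structure M] (hM : K.Mem M) :
    ∃ B : Finset M → L.Substructure M, Monotone B ∧
      ∀ e, K.Strong (B e) ∧ #(B e) ≤ K.LS ∧ (e : Set M) ⊆ B e := by
  let Small := {S : L.Substructure M // K.Strong S ∧ #S ≤ K.LS}
  have exists_small (A : Set M) (hA : #A ≤ K.LS) : ∃ S : Small, A ⊆ (S.1 : Set M) := by
    obtain ⟨S, hS, hAS, hcard⟩ := K.exists_strong_superset hM le_rfl hA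
    exact ⟨⟨S, hS, hcard⟩, hAS⟩
  have : IsDirectedOrder Small := ⟨fun S T => by
    obtain ⟨U, hU⟩ := exists_small (S.1 ∪ T.1) ((mk_union_le _ _).trans
      (add_le_of_le K.aleph0_le_LS S.2.2 T.2.2))
    exact ⟨U, subset_union_left.trans hU, subset_union_right.trans hU⟩⟩
  choose base subset_base using fun e : Finset M =>
    exists_small e (e.finite_toSet.lt_aleph0.le.trans K.aleph0_le_LS)
  have : Nonempty Small := ⟨base ∅⟩
  exact ⟨fun e => (monotoneMajorant base e).1, monotone_monotoneMajorant base, fun e =>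
    ⟨(monotoneMajorant base e).2.1, (monotoneMajorant base e).2.2,
      (subset_base e).trans (le_monotoneMajorant base e)⟩⟩

end AEC

/-- A filter closed under intersections of fewer than `κ` sets, relative to which membership of the
index in sets can be decided once and for all: given `θ` many families `𝒢 e` of fewer than `κ` sets,
one decision `v` is realised on each `𝒢 e` by an index lying in a prescribed member `Y e` of the
filter. -/
structure IsCompactFilter {I : Type u} (F : Filter I) (κ θ : Cardinal.{u}) : Prop
    extends CardinalInterFilter F κ where
  exists_decision : ∀ (E : Type u) (𝒢 : E → Set (Set I)) (Y : E → Set I), #E ≤ θ →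
    (∀ e, #(𝒢 e) < κ) → (∀ e, Y e ∈ F) →
    ∃ v : Set (Set I), ∀ e, ∃ i ∈ Y e, ∀ X ∈ 𝒢 e, (X ∈ v ↔ i ∈ X)

section Formulas

variable {L : FirstOrder.Language.{u, u}}

theorem mk_formula_le {α : Type u} {μ : Cardinal.{u}} (hμ : ℵ₀ ≤ μ) (hL : L.card ≤ μ)
    (hα : #α ≤ μ) : #(L.Formula α) ≤ μ := by
  have sigma_injective : Function.Injective
      fun φ : L.Formula α => (⟨0, φ⟩ : Σ n, L.BoundedFormula α n) :=
    fun _ _ h => by simpa using h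
  refine (mk_le_of_injective sigma_injective).trans
    (BoundedFormula.card_le.trans (max_le hμ ?_))
  simpa only [lift_id] using add_le_of_le hμ hα hL

theorem exists_equiv_of_realize_iff {P Q W : Type u} [L.Structure P] [L.Structure Q]
    {S : L.Substructure P} {T : L.Substructure Q} {a : W → S} {b : W → T}
    (ha : Function.Surjective a) (hb : Function.Surjective b)
    (h : ∀ φ : L.Formula W, φ.Realize (fun w => (a w : P)) ↔ φ.Realize (fun w => (b w : Q))) :
    ∃ e : S ≃[L] T, ∀ w, e (a w) = b w := by
  have eq_iff (u v : W) : a u = a v ↔ b u = b v := by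
    simpa only [Formula.realize_equal, Term.realize_var, Subtype.coe_inj]
      using h (Term.equal (Term.var u) (Term.var v))
  obtain ⟨w, hw⟩ := ha.hasRightInverse
  have b_comp_w (v : W) : b (w (a v)) = b v := (eq_iff _ _).1 (hw _)
  have bijective : Function.Bijective (b ∘ w) :=
    ⟨fun x y hxy => by simpa only [hw _] using (eq_iff (w x) (w y)).2 hxy,
      fun y => let ⟨v, hv⟩ := hb y; ⟨a v, (b_comp_w v).trans hv⟩⟩
  refine ⟨⟨Equiv.ofBijective (b ∘ w) bijective, fun F x => ?_, fun R x => ?_⟩, b_comp_w⟩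
  · have := h (Term.equal (Term.var (w (Structure.funMap F x)))
      (Term.func F fun i => Term.var (w (x i))))
    simp only [Formula.realize_equal, Term.realize_var, Term.realize_func, hw _] at this
    exact Subtype.ext (this.1 rfl)
  · have := h (R.formula fun i => Term.var (w (x i)))
    simp only [Formula.realize_rel, Term.realize_var, hw _] at this
    exact this.symm

end Formulas

namespace AEC

variable {L : FirstOrder.Language.{u, u}} (K : AEC L) {I : Type u}

/-- At most `LS(K)` sections of the family `P`, whose values at each index `i` are the elements of a
strong substructure of `P i`. -/
structure SectionSystem (P : I → Type u) [∀ i, L.Structure (P i)] where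
  carrier : Set (∀ i, P i)
  mk_le : #carrier ≤ K.LS
  model : ∀ i, L.Substructure (P i)
  strong : ∀ i, K.Strong (model i)
  coe_model : ∀ i, (model i : Set (P i)) = Function.eval i '' carrier

namespace SectionSystem

variable {K} {P : I → Type u} [∀ i, L.Structure (P i)]

instance : Preorder (K.SectionSystem P) := Preorder.lift carrier

/-- Evaluation of the sections of the system at an index. -/
def eval (T : K.SectionSystem P) (i : I) (s : T.carrier) : T.model i :=
  ⟨s.1 i, by
    rw [← SetLike.mem_coe, T.coe_model]
    exact ⟨s, s.2, rfl⟩⟩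

theorem eval_surjective (T : K.SectionSystem P) (i : I) : Function.Surjective (T.eval i) := by
  rintro ⟨x, hx⟩
  rw [← SetLike.mem_coe, T.coe_model] at hx
  obtain ⟨s, hs, rfl⟩ := hx
  exact ⟨⟨s, hs⟩, rfl⟩

theorem model_mono {T T' : K.SectionSystem P} (h : T ≤ T') (i : I) : T.model i ≤ T'.model i := by
  rw [← SetLike.coe_subset_coe, T.coe_model, T'.coe_model]
  exact image_mono h

theorem exists_isEmb_of_realize_iff {T T' : K.SectionSystem P} (h : T ≤ T') {i i' : I}
    (hφ : ∀ φ : L.Formula T.carrier,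
      φ.Realize (fun s => s.1 i) ↔ φ.Realize (fun s => s.1 i')) :
    ∃ g : T.model i ↪[L] T'.model i', K.IsEmb g ∧
      ∀ s : T.carrier, g (T.eval i s) = T'.eval i' (Set.inclusion h s) := by
  obtain ⟨e, he⟩ := exists_equiv_of_realize_iff (T.eval_surjective i) (T.eval_surjective i') hφ
  obtain ⟨hle, hstrong⟩ := K.coherence _ _ (model_mono h i') (T.strong i') (T'.strong i')
  exact ⟨(Substructure.inclusion hle).comp e.toEmbedding, isEmb_comp_equiv e hstrong,
    fun s => Subtype.ext (congrArg Subtype.val (he s) :)⟩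

end SectionSystem

end AEC

namespace AEC

variable {L : FirstOrder.Language.{u, u}} (K : AEC L) {I : Type u} {P : I → Type u}
  [∀ i, L.Structure (P i)]

theorem exists_sectionSystem [∀ i, Nonempty (P i)] (hP : ∀ i, K.Mem (P i)) {C : Set (∀ i, P i)}
    (hC : #C ≤ K.LS) : ∃ T : K.SectionSystem P, C ⊆ T.carrier := by
  have mk_values (i : I) : #(insert (Classical.arbitrary (P i)) (Function.eval i '' C) : Set _) ≤
      K.LS :=
    mk_insert_le.trans (add_le_of_le K.aleph0_le_LS (mk_image_le.trans hC)
      (one_le_aleph0.trans K.aleph0_le_LS))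
  choose S hS hCS mk_S using fun i => K.exists_strong_superset (hP i) le_rfl (mk_values i)
  have exists_surjective (i : I) : ∃ g : K.LS.out → S i, Function.Surjective g := by
    have : Nonempty (S i) := ⟨⟨_, hCS i (mem_insert _ _)⟩⟩
    obtain ⟨e⟩ : Nonempty (S i ↪ K.LS.out) := by
      rw [← Cardinal.le_def, mk_out]
      exact mk_S i
    exact ⟨Function.invFun e, Function.invFun_surjective e.injective⟩
  choose g hg using exists_surjective
  refine ⟨⟨C ∪ range fun w i => (g i w : P i), (mk_union_le _ _).trans
    (add_le_of_le K.aleph0_le_LS hC (mk_range_le.trans (mk_out _).le)), S, hS,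
    fun i => subset_antisymm (fun x hx => ?_) ?_⟩, subset_union_left⟩
  · obtain ⟨w, hw⟩ := hg i ⟨x, hx⟩
    exact ⟨_, Or.inr ⟨w, rfl⟩, congrArg Subtype.val hw⟩
  · rintro _ ⟨s, hs | ⟨w, rfl⟩, rfl⟩
    · exact hCS i (mem_insert_of_mem _ ⟨s, hs, rfl⟩)
    · exact (g i w).2

theorem isDirectedOrder_sectionSystem [∀ i, Nonempty (P i)] (hP : ∀ i, K.Mem (P i)) :
    IsDirectedOrder (K.SectionSystem P) :=
  ⟨fun T T' =>
    let ⟨U, hU⟩ := K.exists_sectionSystem hP ((mk_union_le T.carrier T'.carrier).trans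
      (add_le_of_le K.aleph0_le_LS T.mk_le T'.mk_le))
    ⟨U, subset_union_left.trans hU, subset_union_right.trans hU⟩⟩

theorem exists_monotone_sectionSystem [∀ i, Nonempty (P i)] (hP : ∀ i, K.Mem (P i)) {X : Type*}
    {C : Finset X → Set (∀ i, P i)} (hC : ∀ e, #(C e) ≤ K.LS) :
    ∃ T : Finset X → K.SectionSystem P, Monotone T ∧ ∀ e, C e ⊆ (T e).carrier := by
  have := K.isDirectedOrder_sectionSystem hP
  choose base subset_base using fun e => K.exists_sectionSystem hP (hC e)
  have : Nonempty (K.SectionSystem P) := ⟨base ∅⟩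
  exact ⟨monotoneMajorant base, monotone_monotoneMajorant base,
    fun e => (subset_base e).trans (le_monotoneMajorant base e)⟩

namespace SectionSystem

variable {K} {E : Type u}

/-- The indices `j e` are coherent for the family `T` of systems of sections: the values at `j e`
and `j e'` of the sections in `T e` satisfy the same formulas whenever `e ≤ e'`. -/
def IsCoherent [LE E] (T : E → K.SectionSystem P) (j : E → I) : Prop :=
  ∀ ⦃e e'⦄, e ≤ e' → ∀ φ : L.Formula (T e).carrier,
    φ.Realize (fun s => s.1 (j e)) ↔ φ.Realize (fun s => s.1 (j e'))

/-- The sets of indices defined by the formulas about the sections of the system. -/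
def definableSets (T : K.SectionSystem P) : Set (Set I) :=
  range fun φ : L.Formula T.carrier => {i | φ.Realize fun s => s.1 i}

theorem mk_definableSets_le (T : K.SectionSystem P) : #T.definableSets ≤ K.LS :=
  mk_range_le.trans (mk_formula_le K.aleph0_le_LS K.isLSBound_LS.2.1 T.mk_le)

theorem definableSets_mono {T T' : K.SectionSystem P} (h : T ≤ T') :
    T.definableSets ⊆ T'.definableSets := by
  rintro _ ⟨φ, rfl⟩
  exact ⟨φ.relabel (Set.inclusion h), by simp only [Formula.realize_relabel]; rfl⟩

theorem exists_isCoherent [Preorder E] {F : Filter I} {κ θ : Cardinal.{u}}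
    (hF : IsCompactFilter F κ θ) (hκ : K.LS < κ) (hE : #E ≤ θ) {T : E → K.SectionSystem P}
    (hT : Monotone T) {Y : E → Set I} (hY : ∀ e, Y e ∈ F) :
    ∃ j : E → I, (∀ e, j e ∈ Y e) ∧ IsCoherent T j := by
  obtain ⟨v, hv⟩ := hF.exists_decision E (fun e => (T e).definableSets) Y hE
    (fun e => (T e).mk_definableSets_le.trans_lt hκ) hY
  choose j hjY hj using hv
  refine ⟨j, hjY, fun e e' h φ => ?_⟩
  have hφ : {i | φ.Realize fun s => s.1 i} ∈ (T e).definableSets := ⟨φ, rfl⟩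
  exact (hj e _ hφ).symm.trans (hj e' _ (definableSets_mono (hT h) hφ))

end SectionSystem

section Limit

variable {K} {E : Type u} [PartialOrder E] [IsDirectedOrder E] [Nonempty E]

theorem isEmb_directLimit_of {G : E → Type u} [∀ e, L.Structure (G e)]
    {f : ∀ i j, i ≤ j → G i ↪[L] G j} [DirectedSystem G fun i j h => f i j h]
    (hf : ∀ i j h, K.IsEmb (f i j h)) (e : E) : K.IsEmb (DirectLimit.of L E G f e) := by
  refine strong_of_iSup_eq_top (S := fun e => (DirectLimit.of L E G f e).toHom.range)
    (fun i j hij => ?_) (eq_top_iff.2 fun z _ => ?_) e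
  · have of_comp : (DirectLimit.of L E G f j).comp (f i j hij) = DirectLimit.of L E G f i :=
      Embedding.ext fun x => DirectLimit.of_f
    rw [← of_comp]
    exact (K.strongLE_range_comp_iff _ _).2 (hf i j hij)
  · obtain ⟨i, x, rfl⟩ := DirectLimit.exists_of z
    exact le_iSup (fun e => (DirectLimit.of L E G f e).toHom.range) i ⟨x, rfl⟩

theorem SectionSystem.IsCoherent.exists_limit {T : E → K.SectionSystem P} (hT : Monotone T)
    {j : E → I} (hj : IsCoherent T j) :
    ∃ (N : Type u) (_ : L.Structure N) (ι : ∀ e, (T e).model (j e) ↪[L] N)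
      (lim : (⋃ e, (T e).carrier) → N), (∀ e, K.IsEmb (ι e)) ∧
        ∀ e s, lim (Set.inclusion (subset_iUnion _ e) s) = ι e ((T e).eval (j e) s) := by
  choose g isEmb_g g_eval using fun e e' (h : e ≤ e') =>
    exists_isEmb_of_realize_iff (hT h) (hj h)
  have : DirectedSystem (fun e => (T e).model (j e)) fun e e' h => g e e' h :=
    { map_self := fun e x => by
        obtain ⟨s, rfl⟩ := (T e).eval_surjective _ x
        exact g_eval _ _ _ s
      map_map := fun c b a hab hbc x => by
        obtain ⟨s, rfl⟩ := (T a).eval_surjective _ x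
        simp only [g_eval, Set.inclusion_inclusion] }
  let of := DirectLimit.of L E (fun e => (T e).model (j e)) g
  have of_eval (e e') (h : e ≤ e') (s : (T e).carrier) :
      of e ((T e).eval (j e) s) = of e' ((T e').eval (j e') (Set.inclusion (hT h) s)) :=
    (DirectLimit.of_f (f := g)).symm.trans (congrArg (of e') (g_eval e e' h s))
  choose ε hε using fun s : (⋃ e, (T e).carrier) => mem_iUnion.1 s.2
  refine ⟨_, inferInstance, of, fun s => of (ε s) ((T (ε s)).eval _ ⟨s.1, hε s⟩),
    isEmb_directLimit_of isEmb_g, fun e s => ?_⟩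
  obtain ⟨c, hεc, hec⟩ := exists_ge_ge (ε (Set.inclusion (subset_iUnion _ e) s)) e
  exact (of_eval _ c hεc _).trans (of_eval e c hec s).symm

end Limit

end AEC

theorem mk_finset_le {X : Type u} {θ : Cardinal.{u}} (hθ : ℵ₀ ≤ θ) (hX : #X ≤ θ) :
    #(Finset X) ≤ θ := by
  classical
  exact (mk_le_of_surjective List.toFinset_surjective).trans
    ((mk_list_le_max X).trans (max_le hθ hX))

theorem eventually_forall_eq_of_eventually_eq {I X Y : Type u} {P : I → Type*} {F : Filter I}
    {κ : Cardinal.{u}} [CardinalInterFilter F κ] (hX : #X < κ) (hY : #Y < κ) (s : X → ∀ i, P i)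
    (t : Y → ∀ i, P i) :
    ∀ᶠ i in F, ∀ x y, (∀ᶠ i' in F, s x i' = t y i') → s x i = t y i := by
  simp only [eventually_cardinal_forall hX, eventually_cardinal_forall hY,
    eventually_imp_distrib_left, imp_self, implies_true]

namespace AEC

variable {L : FirstOrder.Language.{u, u}} {K : AEC L} {I : Type u} {F : Filter I} {P : I → Type u}
  [∀ i, L.Structure (P i)] {M₁ M₂ : Type u} [L.Structure M₁] [L.Structure M₂]

variable (K F) in
/-- The maps `fun m => s m i` from `M₁` to the `P i` are `K`-embeddings on strong substructures of
`M₁` that approximate `M₁` along `F`: every element of `M₁` eventually lies in them. -/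
def IsLocalEmb (s : M₁ → ∀ i, P i) : Prop :=
  ∃ A : I → L.Substructure M₁, (∀ m, ∀ᶠ i in F, m ∈ A i) ∧
    ∀ i, K.Strong (A i) ∧ K.IsEmbOn (fun m => s m i) (A i)

theorem IsLocalEmb.eventually_isEmbOn {s : M₁ → ∀ i, P i} (hs : K.IsLocalEmb F s)
    {κ : Cardinal.{u}} [CardinalInterFilter F κ] {B : L.Substructure M₁} (hB : K.Strong B)
    (mk_B : #B < κ) : ∀ᶠ i in F, K.IsEmbOn (fun m => s m i) B := by
  obtain ⟨A, hA, hsA⟩ := hs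
  filter_upwards [(eventually_cardinal_forall (p := fun i (b : B) => b.1 ∈ A i) mk_B).2
    fun b => hA b] with i hi
  exact (hsA i).2.mono (K.coherence _ _ (fun b hb => hi ⟨b, hb⟩) hB (hsA i).1)

theorem exists_isEmb_eq_lim {E N : Type u} [PartialOrder E] [IsDirectedOrder E] [Nonempty E]
    [L.Structure N] {B : E → L.Substructure M₁} (hB : Monotone B) (hcov : ∀ m, ∃ e, m ∈ B e)
    {T : E → K.SectionSystem P} {j : E → I} {ι : ∀ e, (T e).model (j e) ↪[L] N}
    (hι : ∀ e, K.IsEmb (ι e)) {lim : (⋃ e, (T e).carrier) → N}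
    (hlim : ∀ e s, lim (Set.inclusion (subset_iUnion _ e) s) = ι e ((T e).eval (j e) s))
    {s : M₁ → ∀ i, P i} (hs : ∀ e, K.IsEmbOn (fun m => s m (j e)) (B e))
    (hBT : ∀ e, ∀ m ∈ B e, s m ∈ (T e).carrier) :
    ∃ k : M₁ ↪[L] N, K.IsEmb k ∧ ∀ m h, k m = lim ⟨s m, h⟩ := by
  have mem_iUnion_carrier (m : M₁) : s m ∈ ⋃ e, (T e).carrier :=
    let ⟨e, he⟩ := hcov m
    mem_iUnion.2 ⟨e, hBT e m he⟩
  obtain ⟨k, hk, hk_eq⟩ := exists_isEmb_eq_of_isEmbOn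
    (f := fun m => lim ⟨s m, mem_iUnion_carrier m⟩) hB hcov fun e =>
    (hs e).comp ((T e).strong (j e))
      (fun m hm => ((T e).eval (j e) ⟨s m, hBT e m hm⟩).2) (hι e)
      fun m hm => hlim e ⟨s m, hBT e m hm⟩
  exact ⟨k, hk, fun m _ => hk_eq m⟩

theorem IsLocalEmb.exists_isCoherent {κ θ : Cardinal.{u}} (hF : IsCompactFilter F κ θ)
    (hκ : K.LS < κ) [∀ i, Nonempty (P i)] (hP : ∀ i, K.Mem (P i)) {s₁ : M₁ → ∀ i, P i}
    {s₂ : M₂ → ∀ i, P i} (hs₁ : K.IsLocalEmb F s₁) (hs₂ : K.IsLocalEmb F s₂) {X : Type u}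
    (mk_X : #(Finset X) ≤ θ) {B₁ : Finset X → L.Substructure M₁}
    {B₂ : Finset X → L.Substructure M₂} (strong_B₁ : ∀ e, K.Strong (B₁ e))
    (mk_B₁ : ∀ e, #(B₁ e) ≤ K.LS) (strong_B₂ : ∀ e, K.Strong (B₂ e))
    (mk_B₂ : ∀ e, #(B₂ e) ≤ K.LS) :
    ∃ (T : Finset X → K.SectionSystem P) (j : Finset X → I), Monotone T ∧
      SectionSystem.IsCoherent T j ∧ (∀ e, ∀ x ∈ B₁ e, s₁ x ∈ (T e).carrier) ∧
      (∀ e, ∀ y ∈ B₂ e, s₂ y ∈ (T e).carrier) ∧ ∀ e,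
        K.IsEmbOn (fun x => s₁ x (j e)) (B₁ e) ∧ K.IsEmbOn (fun y => s₂ y (j e)) (B₂ e) ∧
        ∀ (x : B₁ e) (y : B₂ e), (∀ᶠ i in F, s₁ x i = s₂ y i) → s₁ x (j e) = s₂ y (j e) := by
  have := hF.toCardinalInterFilter
  obtain ⟨T, hT, subset_T⟩ := K.exists_monotone_sectionSystem hP
    (C := fun e => s₁ '' B₁ e ∪ s₂ '' B₂ e) fun e =>
      (mk_union_le _ _).trans (add_le_of_le K.aleph0_le_LS (mk_image_le.trans (mk_B₁ e))
        (mk_image_le.trans (mk_B₂ e)))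
  obtain ⟨j, hjY, hj⟩ := SectionSystem.exists_isCoherent hF hκ mk_X hT fun e =>
    (hs₁.eventually_isEmbOn (strong_B₁ e) ((mk_B₁ e).trans_lt hκ)).and
      ((hs₂.eventually_isEmbOn (strong_B₂ e) ((mk_B₂ e).trans_lt hκ)).and
        (eventually_forall_eq_of_eventually_eq ((mk_B₁ e).trans_lt hκ) ((mk_B₂ e).trans_lt hκ)
          (fun x => s₁ x.1) fun y => s₂ y.1))
  exact ⟨T, j, hT, hj, fun e x hx => subset_T e (Or.inl ⟨x, hx, rfl⟩),
    fun e y hy => subset_T e (Or.inr ⟨y, hy, rfl⟩), hjY⟩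

theorem IsLocalEmb.exists_isEmb {κ θ : Cardinal.{u}} (hF : IsCompactFilter F κ θ) (hκ : K.LS < κ)
    (hθ : ℵ₀ ≤ θ) (mk_M₁ : #M₁ ≤ θ) (mk_M₂ : #M₂ ≤ θ) (hM₁ : K.Mem M₁) (hM₂ : K.Mem M₂)
    [∀ i, Nonempty (P i)] (hP : ∀ i, K.Mem (P i))
    {s₁ : M₁ → ∀ i, P i} {s₂ : M₂ → ∀ i, P i} (hs₁ : K.IsLocalEmb F s₁) (hs₂ : K.IsLocalEmb F s₂) :
    ∃ (N : Type u) (_ : L.Structure N) (k₁ : M₁ ↪[L] N) (k₂ : M₂ ↪[L] N),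
      K.IsEmb k₁ ∧ K.IsEmb k₂ ∧ ∀ x y, (∀ᶠ i in F, s₁ x i = s₂ y i) → k₁ x = k₂ y := by
  classical
  obtain ⟨B₁, hB₁, B₁_spec⟩ := K.exists_strong_cover hM₁
  obtain ⟨B₂, hB₂, B₂_spec⟩ := K.exists_strong_cover hM₂
  choose strong_B₁ mk_B₁ subset_B₁ using B₁_spec
  choose strong_B₂ mk_B₂ subset_B₂ using B₂_spec
  have mk_E : #(Finset (M₁ ⊕ M₂)) ≤ θ := mk_finset_le hθ (by
    simpa only [mk_sum, lift_id] using add_le_of_le hθ mk_M₁ mk_M₂)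
  obtain ⟨T, j, hT, hj, s₁_mem, s₂_mem, hjY⟩ := IsLocalEmb.exists_isCoherent hF hκ hP hs₁ hs₂ mk_E
    (B₁ := fun e => B₁ e.toLeft) (B₂ := fun e => B₂ e.toRight) (fun _ => strong_B₁ _)
    (fun _ => mk_B₁ _) (fun _ => strong_B₂ _) (fun _ => mk_B₂ _)
  choose isEmbOn_s₁ isEmbOn_s₂ agree using hjY
  obtain ⟨N, _, ι, lim, hι, hlim⟩ := hj.exists_limit hT
  obtain ⟨k₁, hk₁, k₁_eq⟩ := exists_isEmb_eq_lim (hB₁.comp Finset.toLeft_monotone)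
    (fun m => ⟨{Sum.inl m}, subset_B₁ _ (by simp)⟩) hι hlim isEmbOn_s₁ s₁_mem
  obtain ⟨k₂, hk₂, k₂_eq⟩ := exists_isEmb_eq_lim (hB₂.comp Finset.toRight_monotone)
    (fun m => ⟨{Sum.inr m}, subset_B₂ _ (by simp)⟩) hι hlim isEmbOn_s₂ s₂_mem
  refine ⟨N, inferInstance, k₁, k₂, hk₁, hk₂, fun x y hxy => ?_⟩
  let e : Finset (M₁ ⊕ M₂) := {Sum.inl x, Sum.inr y}
  have hx : x ∈ B₁ e.toLeft := subset_B₁ _ (by simp [e])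
  have hy : y ∈ B₂ e.toRight := subset_B₂ _ (by simp [e])
  let sx : (T e).carrier := ⟨s₁ x, s₁_mem e x hx⟩
  let sy : (T e).carrier := ⟨s₂ y, s₂_mem e y hy⟩
  calc k₁ x = ι e ((T e).eval (j e) sx) := (k₁_eq x _).trans (hlim e sx)
    _ = ι e ((T e).eval (j e) sy) :=
      congrArg (ι e) (Subtype.ext (agree e ⟨x, hx⟩ ⟨y, hy⟩ hxy))
    _ = k₂ y := ((k₂_eq y _).trans (hlim e sy)).symm

end AEC

namespace AEC

variable {L : FirstOrder.Language.{u, u}} {K : AEC L}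

theorem isAmalgamationBase_of_equiv {ℱ : Set Cardinal.{u}} {M M' : Type u} [L.Structure M]
    [L.Structure M'] (e : M ≃[L] M') (h : K.IsAmalgamationBase ℱ M) :
    K.IsAmalgamationBase ℱ M' := by
  obtain ⟨hM, hcard, amalgam⟩ := h
  refine ⟨K.mem_of_iso e hM, mk_congr e.toEquiv ▸ hcard, fun M₁ M₂ _ _ f₁ f₂ h₁ h₂ hf₁ hf₂ => ?_⟩
  obtain ⟨N, _, g₁, g₂, hg₁, hg₂, hg⟩ := amalgam M₁ M₂ (f₁.comp e.toEmbedding)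
    (f₂.comp e.toEmbedding) h₁ h₂ (isEmb_comp_equiv e hf₁) (isEmb_comp_equiv e hf₂)
  exact ⟨N, inferInstance, g₁, g₂, hg₁, hg₂, e.surjective.forall.2 hg⟩

section Unions

variable {M I : Type u} [L.Structure M] [PartialOrder I] {Ms : I → L.Substructure M}

theorem IsUnionOf.monotone (h : K.IsUnionOf Ms) : Monotone Ms := fun i j hij => (h.1 i j hij).1

theorem IsUnionOf.exists_mem (h : K.IsUnionOf Ms) (m : M) : ∃ i, m ∈ Ms i :=
  mem_iUnion.1 (h.2 ▸ mem_univ m)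

theorem IsUnionOf.strong [IsDirectedOrder I] [Nonempty I] (h : K.IsUnionOf Ms) (i : I) :
    K.Strong (Ms i) :=
  strong_of_iSup_eq_top h.1 (eq_top_iff.2 fun m _ =>
    let ⟨j, hj⟩ := h.exists_mem m
    le_iSup Ms j hj) i

theorem IsUnionOf.eventually_mem (h : K.IsUnionOf Ms) {F : Filter I} (hF : F ≤ atTop) (m : M) :
    ∀ᶠ i in F, m ∈ Ms i := by
  obtain ⟨i, hi⟩ := h.exists_mem m
  filter_upwards [hF (Ici_mem_atTop i)] with j hj using h.monotone hj hi

end Unions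

theorem exists_strong_superset_of_image {M M' : Type u} [L.Structure M'] (hM' : K.Mem M')
    {f : M → M'} (hf : Function.Injective f) {S : Set M} (hS : K.LS ≤ #S) (C : Set M') :
    ∃ A : L.Substructure M', K.Strong A ∧ C ⊆ A ∧ MapsTo f S A ∧ #A ∈ Icc #S (max #S #C) := by
  obtain ⟨A, hA, subset_A, mk_A⟩ := K.exists_strong_superset hM' (A := f '' S ∪ C)
    (hS.trans (le_max_left #S #C)) ((mk_union_le _ _).trans
      (add_le_of_le (K.aleph0_le_LS.trans (hS.trans (le_max_left _ _)))
        (mk_image_le.trans (le_max_left _ _)) (le_max_right _ _)))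
  have image_subset : f '' S ⊆ A := subset_union_left.trans subset_A
  exact ⟨A, hA, subset_union_right.trans subset_A, mapsTo_iff_image_subset.2 image_subset,
    (mk_image_eq hf).ge.trans (mk_le_mk_of_subset image_subset), mk_A⟩

section Amalgamation

variable {I : Type u} {F : Filter I} {M M₁ M₂ : Type u} [L.Structure M] [L.Structure M₁]
  [L.Structure M₂]

theorem isLocalEmb_extend {P : I → Type u} [∀ i, L.Structure (P i)] [∀ i, Nonempty (P i)]
    {A : I → L.Substructure M₁} (hA : ∀ i, K.Strong (A i)) (hcov : ∀ m, ∀ᶠ i in F, m ∈ A i)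
    {g : ∀ i, A i ↪[L] P i} (hg : ∀ i, K.IsEmb (g i)) :
    K.IsLocalEmb F fun m i =>
      Function.extend Subtype.val (g i) (fun _ => Classical.arbitrary (P i)) m :=
  ⟨A, hcov, fun i => ⟨hA i, g i, hg i, fun a => (Subtype.val_injective.extend_apply _ _ a).symm⟩⟩

theorem exists_amalgam_of_bases {κ θ : Cardinal.{u}} (hF : IsCompactFilter F κ θ) (hκ : K.LS < κ)
    (hθ : ℵ₀ ≤ θ) (mk_M₁ : #M₁ ≤ θ) (mk_M₂ : #M₂ ≤ θ) {f₁ : M ↪[L] M₁} {f₂ : M ↪[L] M₂}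
    (hf₁ : K.IsEmb f₁) (hf₂ : K.IsEmb f₂) {Ms : I → L.Substructure M}
    (hMs : ∀ i, K.Strong (Ms i)) (mem_Ms : ∀ m, ∀ᶠ i in F, m ∈ Ms i)
    (LS_le : ∀ i, K.LS ≤ #(Ms i)) {ℱ : I → Set Cardinal.{u}} (hℱ : ∀ i, (ℱ i).OrdConnected)
    (hbase : ∀ i, K.IsAmalgamationBase (ℱ i) (Ms i)) {C₁ : I → Set M₁} {C₂ : I → Set M₂}
    (mk_C₁ : ∀ i, max #(Ms i) #(C₁ i) ∈ ℱ i) (mk_C₂ : ∀ i, max #(Ms i) #(C₂ i) ∈ ℱ i)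
    (mem_C₁ : ∀ m, ∀ᶠ i in F, m ∈ C₁ i) (mem_C₂ : ∀ m, ∀ᶠ i in F, m ∈ C₂ i) :
    ∃ (N : Type u) (_ : L.Structure N) (k₁ : M₁ ↪[L] N) (k₂ : M₂ ↪[L] N),
      K.IsEmb k₁ ∧ K.IsEmb k₂ ∧ ∀ m : M, k₁ (f₁ m) = k₂ (f₂ m) := by
  choose A₁ strong_A₁ subset_A₁ f₁_mem mk_A₁ using fun i =>
    exists_strong_superset_of_image (mem_of_isEmb hf₁) f₁.injective (LS_le i) (C₁ i)
  choose A₂ strong_A₂ subset_A₂ f₂_mem mk_A₂ using fun i =>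
    exists_strong_superset_of_image (mem_of_isEmb hf₂) f₂.injective (LS_le i) (C₂ i)
  have isEmb_restrict {M' : Type u} [L.Structure M'] {f : M ↪[L] M'} (hf : K.IsEmb f) (i) :
      K.IsEmb (f.comp (Ms i).subtype) := isEmb_comp hf ((K.isEmb_subtype_iff _).2 (hMs i))
  choose P _ g₁ g₂ hg₁ hg₂ hg using fun i => (hbase i).2.2 (A₁ i) (A₂ i) _ _
    ((hℱ i).out (hbase i).2.1 (mk_C₁ i) (mk_A₁ i))
    ((hℱ i).out (hbase i).2.1 (mk_C₂ i) (mk_A₂ i))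
    (isEmb_codRestrict (isEmb_restrict hf₁ i) (strong_A₁ i) fun m => f₁_mem i m.2)
    (isEmb_codRestrict (isEmb_restrict hf₂ i) (strong_A₂ i) fun m => f₂_mem i m.2)
  have nonempty_Ms (i) : Nonempty (Ms i) :=
    mk_ne_zero_iff.1 ((aleph0_pos.trans_le K.aleph0_le_LS).trans_le (LS_le i)).ne'
  have : ∀ i, Nonempty (P i) := fun i =>
    (nonempty_Ms i).map fun m => g₁ i ⟨f₁ m.1, f₁_mem i m.2⟩
  obtain ⟨N, _, k₁, k₂, hk₁, hk₂, hk⟩ := IsLocalEmb.exists_isEmb hF hκ hθ mk_M₁ mk_M₂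
    (mem_of_isEmb hf₁) (mem_of_isEmb hf₂) (fun i => mem_of_isEmb (hg₁ i))
    (isLocalEmb_extend strong_A₁ (fun m => (mem_C₁ m).mono fun i h => subset_A₁ i h) hg₁)
    (isLocalEmb_extend strong_A₂ (fun m => (mem_C₂ m).mono fun i h => subset_A₂ i h) hg₂)
  refine ⟨N, inferInstance, k₁, k₂, hk₁, hk₂, fun m => hk _ _ ?_⟩
  filter_upwards [mem_Ms m] with i hm
  rw [Subtype.val_injective.extend_apply _ _ (⟨f₁ m, f₁_mem i hm⟩ : A₁ i),
    Subtype.val_injective.extend_apply _ _ (⟨f₂ m, f₂_mem i hm⟩ : A₂ i)]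
  exact hg i ⟨m, hm⟩

theorem isAmalgamationBase_of_isCompactFilter {κ θ : Cardinal.{u}} (hF : IsCompactFilter F κ θ)
    (hκ : K.LS < κ) (hθ : ℵ₀ ≤ θ) (hM : K.Mem M) {𝒢 : Set Cardinal.{u}} (mk_M : #M ∈ 𝒢)
    (h𝒢 : ∀ c ∈ 𝒢, c ≤ θ) {Ms : I → L.Substructure M}
    (hMs : ∀ i, K.Strong (Ms i)) (mem_Ms : ∀ m, ∀ᶠ i in F, m ∈ Ms i)
    (LS_le : ∀ i, K.LS ≤ #(Ms i)) {ℱ : I → Set Cardinal.{u}} (hℱ : ∀ i, (ℱ i).OrdConnected)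
    (hbase : ∀ i, K.IsAmalgamationBase (ℱ i) (Ms i)) {D : I → Set θ.ord.ToType}
    (mk_D : ∀ i, max #(Ms i) #(D i) ∈ ℱ i) (mem_D : ∀ x, ∀ᶠ i in F, x ∈ D i) :
    K.IsAmalgamationBase 𝒢 M := by
  refine ⟨hM, mk_M, fun M₁ M₂ _ _ f₁ f₂ mk_M₁ mk_M₂ hf₁ hf₂ => ?_⟩
  have exists_embedding {M' : Type u} (h : #M' ∈ 𝒢) : Nonempty (M' ↪ θ.ord.ToType) := by
    rw [← Cardinal.le_def, mk_ord_toType]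
    exact h𝒢 _ h
  obtain ⟨e₁⟩ := exists_embedding mk_M₁
  obtain ⟨e₂⟩ := exists_embedding mk_M₂
  have mk_preimage {M' : Type u} (e : M' ↪ θ.ord.ToType) (i) :
      max #(Ms i) #(e ⁻¹' D i) ∈ ℱ i :=
    (hℱ i).out (hbase i).2.1 (mk_D i) ⟨le_max_left _ _,
      max_le_max_left _ (mk_preimage_of_injective _ _ e.injective)⟩
  exact exists_amalgam_of_bases hF hκ hθ (h𝒢 _ mk_M₁) (h𝒢 _ mk_M₂) hf₁ hf₂ hMs mem_Ms LS_le hℱ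
    hbase (mk_preimage e₁) (mk_preimage e₂) (fun m => mem_D (e₁ m)) fun m => mem_D (e₂ m)

end Amalgamation

end AEC

theorem bddAbove_of_mk_lt_cof {α : Type u} [LinearOrder α] {s : Set α} (hs : #s < Order.cof α) :
    BddAbove s :=
  .of_not_isCofinal fun h => (Order.cof_le h).not_gt hs

theorem cardinalInterFilter_atTop (α : Type u) [LinearOrder α] [Nonempty α] :
    CardinalInterFilter (atTop : Filter α) (Order.cof α) := by
  refine ⟨fun 𝒮 mk_𝒮 h𝒮 => ?_⟩
  choose a ha using fun S : 𝒮 => mem_atTop_sets.1 (h𝒮 S S.2)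
  obtain ⟨b, hb⟩ := bddAbove_of_mk_lt_cof (mk_range_le.trans_lt mk_𝒮 : #(range a) < Order.cof α)
  exact mem_atTop_sets.2 ⟨b, fun c hc S hS => ha ⟨S, hS⟩ c ((hb (mem_range_self _)).trans hc)⟩

section Ultrafilters

variable {I : Type u} (U : Ultrafilter I) {κ : Cardinal.{u}} [CardinalInterFilter (U : Filter I) κ]

theorem eventually_forall_mem_iff {T : Type u} (hT : #T < κ) (G : T → Set I) :
    ∀ᶠ i in (U : Filter I), ∀ t, i ∈ G t ↔ G t ∈ U := by
  refine (eventually_cardinal_forall hT).2 fun t => ?_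
  by_cases ht : G t ∈ U
  · filter_upwards [ht] with i hi using iff_of_true hi ht
  · filter_upwards [Ultrafilter.compl_mem_iff_notMem.2 ht] with i hi using iff_of_false hi ht

theorem isCompactFilter_of_ultrafilter (θ : Cardinal.{u}) :
    IsCompactFilter (U : Filter I) κ θ where
  cardinal_sInter_mem := CardinalInterFilter.cardinal_sInter_mem
  exists_decision E 𝒢 Y _ mk_𝒢 hY := by
    refine ⟨{X | X ∈ U}, fun e => ?_⟩
    obtain ⟨i, hi, hiY⟩ := ((eventually_forall_mem_iff U (mk_𝒢 e) Subtype.val).and (hY e)).exists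
    exact ⟨i, hiY, fun X hX => (hi ⟨X, hX⟩).symm⟩

theorem two_power_lt_mk (hU : ∀ i, ∀ᶠ j in (U : Filter I), j ≠ i) {μ : Cardinal.{u}} (hμ : μ < κ) :
    2 ^ μ < #I := by
  by_contra! mk_I
  induction μ using Cardinal.inductionOn with | _ T
  obtain ⟨f⟩ : Nonempty (I ↪ Set T) := by rwa [← Cardinal.le_def, mk_set]
  have f_eventually_const : ∀ᶠ i in (U : Filter I), f i = {t | {j | t ∈ f j} ∈ U} := by
    filter_upwards [eventually_forall_mem_iff U hμ fun t => {j | t ∈ f j}] with i hi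
    exact Set.ext hi
  obtain ⟨i, hi⟩ := f_eventually_const.exists
  obtain ⟨j, hj, hji⟩ := (f_eventually_const.and (hU i)).exists
  exact hji (f.injective (hj.trans hi.symm))

end Ultrafilters

/-! ### Weakly compact cardinals -/

namespace InfFormula

variable {L : FirstOrder.Language.{u, u}} {κ : Cardinal.{u}} {α : Type u}

/-- The disjunction of fewer than `κ` formulas. -/
def disj (I : Type u) (hI : #I < κ) (φ : I → InfFormula L κ α) : InfFormula L κ α :=
  .neg (.conj I hI fun i => .neg (φ i))

open Classical in
/-- The formula `φ` or its negation, according to whether `p` holds. -/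
noncomputable def signed (φ : InfFormula L κ α) (p : Prop) : InfFormula L κ α :=
  if p then φ else .neg φ

variable {M : Type u} [L.Structure M] {v : α → M}

theorem realize_disj {I : Type u} {hI : #I < κ} {φ : I → InfFormula L κ α} :
    (disj I hI φ).Realize M v ↔ ∃ i, (φ i).Realize M v := by
  simp only [disj, Realize, not_forall, not_not]

theorem realize_signed {φ : InfFormula L κ α} {p : Prop} :
    (φ.signed p).Realize M v ↔ (φ.Realize M v ↔ p) := by
  by_cases hp : p <;> simp [signed, hp, Realize]

end InfFormula

/-- The propositional language with a variable for each subset of `I`. -/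
def subsetLanguage (I : Type u) : FirstOrder.Language.{u, u} :=
  ⟨fun _ => PEmpty, fun _ => Set I⟩

section DecisionSentence

variable {I : Type u} {κ : Cardinal.{u}}

variable (κ) in
/-- The propositional variable attached to the set `X`. -/
def subsetAtom (X : Set I) : InfSentence (subsetLanguage I) κ :=
  .rel (n := 0) X Fin.elim0

/-- The one-point structure in which the variable attached to `X` holds when `i ∈ X`. -/
@[reducible] def pointStructure (i : I) : (subsetLanguage I).Structure PUnit.{u + 1} where
  funMap f := f.elim
  RelMap := fun (X : Set I) _ => i ∈ X

theorem realize_subsetAtom_pointStructure (i : I) (X : Set I) :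
    letI := pointStructure i
    (subsetAtom κ X).Realize PUnit PEmpty.elim ↔ i ∈ X :=
  Iff.rfl

/-- Some `i ∈ Y` lies in exactly those sets of `𝒢` whose variable holds. Only the traces on `𝒢` of
the points of `Y` enter, so that the disjunction has at most `2 ^ #𝒢` terms. -/
noncomputable def decisionSentence (𝒢 : Set (Set I)) (Y : Set I) (h𝒢 : #𝒢 < κ)
    (h𝒢' : #(Set 𝒢) < κ) : InfSentence (subsetLanguage I) κ :=
  .disj ((fun i => {X : 𝒢 | i ∈ X.1}) '' Y) ((mk_set_le _).trans_lt h𝒢') fun p =>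
    .conj 𝒢 h𝒢 fun X => (subsetAtom κ X.1).signed (X ∈ p.1)

theorem realize_decisionSentence {𝒢 : Set (Set I)} {Y : Set I} {h𝒢 : #𝒢 < κ} {h𝒢' : #(Set 𝒢) < κ}
    {M : Type u} [(subsetLanguage I).Structure M] :
    (decisionSentence 𝒢 Y h𝒢 h𝒢').Realize M PEmpty.elim ↔
      ∃ i ∈ Y, ∀ X ∈ 𝒢, ((subsetAtom κ X).Realize M PEmpty.elim ↔ i ∈ X) := by
  simp only [decisionSentence, InfFormula.realize_disj, InfFormula.Realize,
    InfFormula.realize_signed, Subtype.exists, Subtype.forall, exists_mem_image, mem_ofPred_eq,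
    exists_prop]

end DecisionSentence

theorem IsWeaklyCompact.isCompactFilter {κ : Cardinal.{u}} (hκ : IsWeaklyCompact κ) {I : Type u}
    {F : Filter I} [F.NeBot] [CardinalInterFilter F κ] : IsCompactFilter F κ κ where
  cardinal_sInter_mem := CardinalInterFilter.cardinal_sInter_mem
  exists_decision E 𝒢 Y mk_E mk_𝒢 hY := by
    have mk_set_𝒢 (e : E) : #(Set (𝒢 e)) < κ := mk_set.trans_lt (hκ.1.isStrongPrelimit (mk_𝒢 e))
    let χ (e : E) : InfSentence (subsetLanguage I) κ :=
      decisionSentence (𝒢 e) (Y e) (mk_𝒢 e) (mk_set_𝒢 e)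
    have mk_range_χ : #(range χ) ≤ Cardinal.lift.{u + 1} κ := by
      have mk_range_le := mk_range_le_lift (f := χ)
      rw [Cardinal.lift_id'.{u, u + 1}] at mk_range_le
      exact mk_range_le.trans (Cardinal.lift_le.2 mk_E)
    obtain ⟨M, _, -, hM⟩ := hκ.2 _ (range χ) mk_range_χ fun T hT mk_T => by
      choose c hc using fun φ : T => hT φ.2
      have mk_range_c : #(range c) < κ := by
        have mk_range_le := mk_range_le_lift (f := c)
        rw [Cardinal.lift_id'.{u, u + 1}] at mk_range_le
        exact Cardinal.lift_lt.1 (mk_range_le.trans_lt mk_T)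
      obtain ⟨i, hi⟩ := ((eventually_cardinal_forall mk_range_c).2 fun e => hY e.1).exists
      let str := pointStructure i
      refine ⟨PUnit, str, inferInstance, fun φ hφ => ?_⟩
      have hφ_eq : χ (c ⟨φ, hφ⟩) = φ := hc ⟨φ, hφ⟩
      rw [← hφ_eq]
      exact realize_decisionSentence.2 ⟨i, hi ⟨_, mem_range_self _⟩, fun X _ =>
        realize_subsetAtom_pointStructure i X⟩
    exact ⟨{X | (subsetAtom κ X).Realize M PEmpty.elim}, fun e =>
      realize_decisionSentence.1 (hM _ (mem_range_self e))⟩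

/-! ### Measurable and strongly compact cardinals -/

/-- The set function `m` is additive on disjoint families of fewer than `κ` sets. -/
def IsAdditiveBelow {X : Type u} (κ : Cardinal.{u}) (m : Set X → ENNReal) : Prop :=
  ∀ 𝒜 : Set (Set X), #𝒜 < κ → 𝒜.PairwiseDisjoint id → m (⋃₀ 𝒜) = ∑' A : 𝒜, m A

namespace IsAdditiveBelow

variable {X : Type u} {κ : Cardinal.{u}} {m : Set X → ENNReal} (hm : IsAdditiveBelow κ m)
  (hκ : ℵ₀ ≤ κ)
include hm hκ

theorem empty : m ∅ = 0 := by
  have := hm ∅ (by simpa only [mk_eq_zero] using aleph0_pos.trans_le hκ) (pairwiseDisjoint_empty)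
  rwa [sUnion_empty, tsum_empty] at this

theorem union {A B : Set X} (hAB : Disjoint A B) : m (A ∪ B) = m A + m B := by
  classical
  rcases eq_or_ne A B with rfl | hne
  · rw [disjoint_self.1 hAB, bot_eq_empty, union_self, hm.empty hκ, add_zero]
  · have h := hm {A, B} ((lt_aleph0_of_finite _).trans_le hκ)
      (pairwise_pair.2 fun _ => ⟨hAB, hAB.symm⟩)
    rwa [sUnion_pair, ← Finset.coe_pair, Finset.tsum_subtype', Finset.sum_pair hne] at h

theorem eq_zero_of_subset {A B : Set X} (hAB : A ⊆ B) (hB : m B = 0) : m A = 0 := by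
  have h := hm.union hκ (disjoint_sdiff_right (s := A) (t := B))
  rw [union_sdiff_cancel hAB, hB] at h
  exact (add_eq_zero.1 h.symm).1

theorem sUnion_eq_zero {𝒮 : Set (Set X)} (mk_𝒮 : #𝒮 < κ) (h𝒮 : ∀ A ∈ 𝒮, m A = 0) :
    m (⋃₀ 𝒮) = 0 := by
  choose c hc mem_c using fun x : ⋃₀ 𝒮 => x.2
  let fibre (A : 𝒮) : Set X := {x | ∃ hx : x ∈ ⋃₀ 𝒮, c ⟨x, hx⟩ = A}
  have fibre_subset (A : 𝒮) : fibre A ⊆ A := by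
    rintro x ⟨hx, hA⟩
    exact hA ▸ mem_c ⟨x, hx⟩
  have sUnion_fibre : ⋃₀ range fibre = ⋃₀ 𝒮 := by
    refine subset_antisymm (sUnion_subset ?_) fun x hx =>
      ⟨_, ⟨⟨_, hc ⟨x, hx⟩⟩, rfl⟩, hx, rfl⟩
    rintro _ ⟨A, rfl⟩ x ⟨hx, -⟩
    exact hx
  have fibre_disjoint : (range fibre).PairwiseDisjoint id := by
    rintro _ ⟨A, rfl⟩ _ ⟨B, rfl⟩ hne
    refine Set.disjoint_left.2 ?_
    rintro x ⟨hx, hA⟩ ⟨_, hB⟩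
    exact hne (congrArg fibre (Subtype.ext (hA.symm.trans hB)))
  rw [← sUnion_fibre, hm _ (mk_range_le.trans_lt mk_𝒮) fibre_disjoint, ENNReal.tsum_eq_zero]
  rintro ⟨_, A, rfl⟩
  exact hm.eq_zero_of_subset hκ (fibre_subset A) (h𝒮 A A.2)

end IsAdditiveBelow

theorem IsMeasurable.exists_ultrafilter {κ : Cardinal.{u}} (hκ : IsMeasurable κ) :
    ∃ U : Ultrafilter κ.ord.ToType,
      CardinalInterFilter (U : Filter κ.ord.ToType) κ ∧ (U : Filter κ.ord.ToType) ≤ atTop := by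
  obtain ⟨hκ, m, m_eq, m_univ, m_singleton, hm : IsAdditiveBelow κ m⟩ := hκ
  have two_lt : 2 < κ := natCast_lt_aleph0.trans hκ
  let F : Filter κ.ord.ToType := .ofCardinalUnion {A | m A = 0} two_lt
    (fun 𝒮 mk_𝒮 h𝒮 => hm.sUnion_eq_zero hκ.le mk_𝒮 h𝒮)
    fun B hB A hAB => hm.eq_zero_of_subset hκ.le hAB hB
  have mem_F {A : Set κ.ord.ToType} : A ∈ F ↔ m Aᶜ = 0 := Iff.rfl
  have hF : CardinalInterFilter F κ := inferInstance
  have compl_notMem_iff (A : Set κ.ord.ToType) : Aᶜ ∉ F ↔ A ∈ F := by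
    have add_compl : m A + m Aᶜ = 1 := by
      rw [← hm.union hκ.le disjoint_compl_right, union_compl_self, m_univ]
    rw [mem_F, mem_F, compl_compl]
    rcases m_eq A with h | h <;> rcases m_eq Aᶜ with h' | h' <;> simp_all
  refine ⟨.ofComplNotMemIff F compl_notMem_iff, hF, le_iInf fun a => le_principal_iff.2 ?_⟩
  have mk_Iio : #(Iio a) < κ := (mk_Iio_lt a (by simp)).trans_eq (mk_ord_toType κ)
  have hIio : m (⋃₀ (singleton '' Iio a)) = 0 :=
    hm.sUnion_eq_zero hκ.le (mk_image_le.trans_lt mk_Iio) <| by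
      rintro _ ⟨b, -, rfl⟩
      exact m_singleton b
  rwa [sUnion_image, biUnion_of_singleton, ← compl_Ici] at hIio

namespace AEC

variable {L : FirstOrder.Language.{u, u}} {K : AEC L} {κ : Cardinal.{u}} {M : Type u}
  [L.Structure M]

theorem isAmalgamationBase_of_isWeaklyCompact (hκ : K.LS < κ) (hwc : IsWeaklyCompact κ)
    {Ms : κ.ord.ToType → L.Substructure M} (hM : K.Mem M) (mk_M : #M = κ) (hMs : K.IsUnionOf Ms)
    (hbase : ∀ i, K.IsAmalgamationBase (Ico K.LS κ) (Ms i)) : K.IsAmalgamationBase {κ} M := by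
  have aleph0_le : ℵ₀ ≤ κ := hwc.1.aleph0_lt.le
  have : Nonempty κ.ord.ToType := Cardinal.nonempty_ord_toType (aleph0_pos.trans_le aleph0_le).ne'
  have : CardinalInterFilter (atTop : Filter κ.ord.ToType) κ := by
    simpa only [Ordinal.cof_toType, hwc.1.isRegular.cof_ord] using
      cardinalInterFilter_atTop κ.ord.ToType
  have mk_Iic_lt (i : κ.ord.ToType) : #(Iic i) < κ :=
    (Cardinal.mk_Iic_lt i (by simp) (by rwa [mk_ord_toType])).trans_eq (mk_ord_toType κ)
  exact isAmalgamationBase_of_isCompactFilter hwc.isCompactFilter hκ aleph0_le hM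
    (mem_singleton_iff.2 mk_M) (fun c hc => (mem_singleton_iff.1 hc).le) hMs.strong
    (hMs.eventually_mem le_rfl) (fun i => (hbase i).2.1.1) (fun _ => ordConnected_Ico) hbase
    (D := Iic) (fun i => ⟨(hbase i).2.1.1.trans (le_max_left _ _),
      max_lt (hbase i).2.1.2 (mk_Iic_lt i)⟩) Ici_mem_atTop

theorem isAmalgamationBase_of_isStronglyCompactUpTo {lam : Cardinal.{u}} (hκ : K.LS < κ)
    (hsc : IsStronglyCompactUpTo κ lam) {Ms : Pk κ lam → L.Substructure M} (hM : K.Mem M)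
    (mk_M : #M ≤ lam) (hMs : K.IsUnionOf Ms)
    (hbase : ∀ x, K.IsAmalgamationBase (Ico K.LS κ) (Ms x)) :
    K.IsAmalgamationBase (Icc K.LS lam) M := by
  obtain ⟨-, κ_le, U, hU, fine⟩ := hsc
  have : CardinalInterFilter (U : Filter (Pk κ lam)) κ := ⟨hU⟩
  have aleph0_le : ℵ₀ ≤ κ := K.aleph0_le_LS.trans hκ.le
  have : IsDirectedOrder (Pk κ lam) := ⟨fun x y => ⟨⟨x.1 ∪ y.1,
    (mk_union_le _ _).trans_lt (add_lt_of_lt aleph0_le x.2 y.2)⟩, subset_union_left,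
    subset_union_right⟩⟩
  have : Nonempty (Pk κ lam) :=
    ⟨⟨∅, by simpa only [mk_eq_zero] using aleph0_pos.trans_le aleph0_le⟩⟩
  have U_le : (U : Filter (Pk κ lam)) ≤ atTop := le_iInf fun x => le_principal_iff.2 <| by
    filter_upwards [(eventually_cardinal_forall x.2).2 fun a => fine a.1] with y hy a ha
    exact hy ⟨a, ha⟩
  exact isAmalgamationBase_of_isCompactFilter (isCompactFilter_of_ultrafilter U lam) hκ
    (aleph0_le.trans κ_le) hM
    ⟨(hbase (Classical.arbitrary _)).2.1.1.trans (mk_set_le _), mk_M⟩ (fun c hc => hc.2)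
    hMs.strong (hMs.eventually_mem U_le) (fun x => (hbase x).2.1.1) (fun _ => ordConnected_Ico)
    hbase (D := Subtype.val) (fun x => ⟨(hbase x).2.1.1.trans (le_max_left _ _),
      max_lt (hbase x).2.1.2 x.2⟩) fine

end AEC

theorem mk_initialSegment_le (c ν : Cardinal.{u}) :
    #{x : c.ord.ToType | (x.toOrd : Ordinal.{u}) < ν.ord} ≤ ν := by
  conv_rhs => rw [← mk_ord_toType ν]
  refine mk_le_of_injective (f := fun x : {x : c.ord.ToType | (x.toOrd : Ordinal.{u}) < ν.ord} =>
    Ordinal.ToType.mk ⟨x.1.toOrd, x.2⟩) fun x y h => ?_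
  have toOrd_eq := Subtype.mk.inj (Ordinal.ToType.mk.injective h)
  exact Subtype.ext (Ordinal.ToType.mk.symm.injective (Subtype.ext toOrd_eq))

namespace AEC

variable {L : FirstOrder.Language.{u, u}} {K : AEC L} {κ : Cardinal.{u}} {M : Type u}
  [L.Structure M]

section Unions

variable {I : Type u} [PartialOrder I] {F : Filter I} [F.NeBot] [CardinalInterFilter F κ]
  {Ms : I → L.Substructure M}

theorem IsUnionOf.exists_subset_of_mk_lt (h : K.IsUnionOf Ms) (hF : F ≤ atTop) {C : Set M}
    (mk_C : #C < κ) : ∃ i, C ⊆ Ms i := by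
  obtain ⟨i, hi⟩ := ((eventually_cardinal_forall mk_C).2 fun m => h.eventually_mem hF m.1).exists
  exact ⟨i, fun m hm => hi ⟨m, hm⟩⟩

theorem IsUnionOf.mk_le_of_forall_mk_le (h : K.IsUnionOf Ms) (hF : F ≤ atTop) {ν : Cardinal.{u}}
    (hν : Order.succ ν < κ) (mk_Ms : ∀ i, #(Ms i) ≤ ν) : #M ≤ ν := by
  by_contra! ν_lt
  obtain ⟨C, mk_C⟩ := le_mk_iff_exists_set.1 (Order.succ_le_of_lt ν_lt)
  obtain ⟨i, hi⟩ := h.exists_subset_of_mk_lt hF (mk_C.trans_lt hν)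
  exact ((Order.lt_succ ν).trans_eq mk_C.symm).not_ge ((mk_le_mk_of_subset hi).trans (mk_Ms i))

theorem IsUnionOf.mk_eq_iSup (h : K.IsUnionOf Ms) (aleph0_le : ℵ₀ ≤ ⨆ i, #(Ms i))
    (mk_I : #I ≤ ⨆ i, #(Ms i)) : #M = ⨆ i, #(Ms i) := by
  refine le_antisymm ?_ (ciSup_le' fun i => mk_set_le _)
  rw [← mk_univ, ← h.2]
  exact (mk_iUnion_le _).trans (mul_le_of_le aleph0_le mk_I le_rfl)

end Unions

section Measurable

variable {U : Ultrafilter κ.ord.ToType} [CardinalInterFilter (U : Filter κ.ord.ToType) κ]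
  {Ms : κ.ord.ToType → L.Substructure M}

theorem isAmalgamationBase_of_iSup_lt (hU : (U : Filter κ.ord.ToType) ≤ atTop)
    (aleph0_le : ℵ₀ ≤ κ) (hMs : K.IsUnionOf Ms)
    (hbase : ∀ i, K.IsAmalgamationBase {#(Ms i)} (Ms i)) (iSup_lt : ⨆ i, #(Ms i) < κ) :
    K.IsAmalgamationBase {⨆ i, #(Ms i)} M := by
  have le_iSup (i) : #(Ms i) ≤ ⨆ i, #(Ms i) := le_ciSup bddAbove_of_small i
  have := Cardinal.noMaxOrder aleph0_le
  have eventually_ne (i) : ∀ᶠ j in (U : Filter κ.ord.ToType), j ≠ i := by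
    filter_upwards [hU (Ioi_mem_atTop i)] with j hij using ne_of_gt hij
  have two_power_lt : 2 ^ (⨆ i, #(Ms i)) < κ :=
    (two_power_lt_mk U eventually_ne iSup_lt).trans_eq (mk_ord_toType κ)
  have mk_M_le : #M ≤ ⨆ i, #(Ms i) :=
    hMs.mk_le_of_forall_mk_le hU ((Order.succ_le_of_lt (cantor _)).trans_lt two_power_lt) le_iSup
  obtain ⟨i, hi⟩ := hMs.exists_subset_of_mk_lt hU
    (mk_univ.trans_lt (mk_M_le.trans_lt iSup_lt))
  have hi_top : Ms i = ⊤ := top_le_iff.1 hi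
  have mk_Ms_i : #(Ms i) = ⨆ i, #(Ms i) := by
    refine le_antisymm (le_iSup i) (ciSup_le' fun j => (mk_set_le _).trans_eq ?_)
    rw [hi_top]
    exact (mk_congr Substructure.topEquiv.toEquiv).symm
  have hbase_i := hbase i
  rw [mk_Ms_i, hi_top] at hbase_i
  exact isAmalgamationBase_of_equiv Substructure.topEquiv hbase_i

theorem isAmalgamationBase_of_le_iSup (hU : (U : Filter κ.ord.ToType) ≤ atTop) (hκ : K.LS < κ)
    (hM : K.Mem M) (hMs : K.IsUnionOf Ms) (hbase : ∀ i, K.IsAmalgamationBase {#(Ms i)} (Ms i))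
    (le_iSup : κ ≤ ⨆ i, #(Ms i)) : K.IsAmalgamationBase {⨆ i, #(Ms i)} M := by
  have aleph0_le : ℵ₀ ≤ ⨆ i, #(Ms i) := (K.aleph0_le_LS.trans hκ.le).trans le_iSup
  have mk_M : #M = ⨆ i, #(Ms i) := hMs.mk_eq_iSup aleph0_le (by rwa [mk_ord_toType])
  obtain ⟨i₀, LS_lt⟩ := exists_lt_of_lt_ciSup' (hκ.trans_le le_iSup)
  have : Nonempty κ.ord.ToType := ⟨i₀⟩
  have mk_mono : Monotone fun i => #(Ms i) := fun i j hij => mk_le_mk_of_subset (hMs.monotone hij)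
  let D (i : κ.ord.ToType) : Set (⨆ i, #(Ms i)).ord.ToType :=
    {x | (x.toOrd : Ordinal.{u}) < (#(Ms (max i i₀))).ord}
  have mem_D (x) : ∀ᶠ i in (U : Filter κ.ord.ToType), x ∈ D i := by
    obtain ⟨i, hi⟩ := exists_lt_of_lt_ciSup' (lt_ord.1 (mem_Iio.1 x.toOrd.2))
    filter_upwards [hU (Ici_mem_atTop i)] with j hij
    exact lt_ord.2 (hi.trans_le (mk_mono (le_max_of_le_left hij)))
  have mem_Ms (m) : ∀ᶠ i in (U : Filter κ.ord.ToType), m ∈ Ms (max i i₀) :=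
    (hMs.eventually_mem hU m).mono fun i hi => hMs.monotone (le_max_left i i₀) hi
  exact isAmalgamationBase_of_isCompactFilter (isCompactFilter_of_ultrafilter U _) hκ aleph0_le hM
    (mem_singleton_iff.2 mk_M) (fun c hc => (mem_singleton_iff.1 hc).le)
    (fun i => hMs.strong (max i i₀)) mem_Ms
    (fun i => LS_lt.le.trans (mk_mono (le_max_right i i₀))) (fun _ => ordConnected_singleton)
    (fun i => hbase (max i i₀)) (fun i => max_eq_left (mk_initialSegment_le _ _)) mem_D

theorem isAmalgamationBase_of_isMeasurable {lam : κ.ord.ToType → Cardinal.{u}} (hκ : K.LS < κ)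
    (hme : IsMeasurable κ) (hM : K.Mem M) (hMs : K.IsUnionOf Ms)
    (hbase : ∀ i, K.IsAmalgamationBase {lam i} (Ms i)) : K.IsAmalgamationBase {⨆ i, lam i} M := by
  obtain rfl : lam = fun i => #(Ms i) := funext fun i => (hbase i).2.1.symm
  obtain ⟨U, _, hU⟩ := hme.exists_ultrafilter
  rcases lt_or_ge (⨆ i, #(Ms i)) κ with iSup_lt | le_iSup
  · exact isAmalgamationBase_of_iSup_lt hU hme.1.le hMs hbase iSup_lt
  · exact isAmalgamationBase_of_le_iSup hU hκ hM hMs hbase le_iSup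

end Measurable

end AEC

end AECLC

theorem mainTheorem4 {L : FirstOrder.Language.{u, u}} (K : AECLC.AEC L) (κ : Cardinal.{u})
    (hκ : K.LS < κ) :
    -- weakly compact cardinals
    (AECLC.IsWeaklyCompact κ →
      ∀ (M : Type u) [L.Structure M] (Ms : κ.ord.ToType → L.Substructure M),
        K.Mem M → #M = κ → K.IsUnionOf Ms →
        (∀ i, K.IsAmalgamationBase (Set.Ico K.LS κ) (Ms i)) →
        K.IsAmalgamationBase {κ} M) ∧
    -- measurable cardinals
    (AECLC.IsMeasurable κ →
      ∀ (M : Type u) [L.Structure M] (Ms : κ.ord.ToType → L.Substructure M)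
        (lam : κ.ord.ToType → Cardinal.{u}),
        K.Mem M → K.IsUnionOf Ms →
        (∀ i, K.IsAmalgamationBase {lam i} (Ms i)) →
        K.IsAmalgamationBase {⨆ i, lam i} M) ∧
    -- partially strongly compact cardinals
    (∀ lam : Cardinal.{u}, AECLC.IsStronglyCompactUpTo κ lam →
      ∀ (M : Type u) [L.Structure M] (Ms : AECLC.Pk κ lam → L.Substructure M),
        K.Mem M → #M ≤ lam → K.IsUnionOf Ms →
        (∀ x, K.IsAmalgamationBase (Set.Ico K.LS κ) (Ms x)) →
        K.IsAmalgamationBase (Set.Icc K.LS lam) M) :=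
  ⟨fun hwc _ _ _ hM mk_M hMs hbase =>
      AECLC.AEC.isAmalgamationBase_of_isWeaklyCompact hκ hwc hM mk_M hMs hbase,
    fun hme _ _ _ _ hM hMs hbase =>
      AECLC.AEC.isAmalgamationBase_of_isMeasurable hκ hme hM hMs hbase,
    fun _ hsc _ _ _ hM mk_M hMs hbase =>
      AECLC.AEC.isAmalgamationBase_of_isStronglyCompactUpTo hκ hsc hM mk_M hMs hbase⟩
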